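/- **Setting.** Let $X$ be a complex vector space and write $M_n(X)$ for the $n\times n$-matrices over $X$. A *semi-matrix ordered operator space* (SMOS) structure on $X$ consists of * a conjugate-linear involution $*$ on $X$, inducing $[x_{kl}]^*=[x_{lk}^*]$ on $M_n(X)$; * norms on all $M_n(X)$ that make $X$ an operator space, i.e. $\|\alpha x\beta+\gamma y\delta\|\le \|\alpha\alpha^*+\gamma\gamma^*\|^{1/2}\,\|\beta^*\beta+\delta^*\delta\|^{1/2}\max\{\|x\|,\|y\|\}$ for all matrices $x,y$ over $X$ and all scalar matrices $\alpha,\beta,\gamma,\delta$ of suitable sizes, and for which the involution of each $M_n(X)$ is isometric; $X=M_1(X)$ is regarded as a normed space, not assumed complete; * norm closed sets $M_n(X)_+\subseteq M_n(X)_{\mathrm{sa}}$ (the matrix cone, not assumed proper or generating) with $\alpha^*x\alpha+\beta^*y\beta\in M_k(X)_+$ for $x\in M_m(X)_+$, $y\in M_n(X)_+$, $\alpha\in M_{m,k}$, $\beta\in M_{n,k}$. The dual $X^*$ of a SMOS is a SMOS: its involution is $f^*(x)=\overline{f(x^*)}$; an element $f=[f_{kl}]\in M_n(X^*)$ is regarded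 as the map $X\to M_n$, $x\mapsto[f_{kl}(x)]$, its norm is the completely bounded norm $\sup\{\|f^{(m)}(x)\|: m\in\mathbb N,\ x\in M_m(X),\ \|x\|\le1\}$, and $f\in M_n(X^*)_+$ iff this map is self-adjoint and completely positive. The bidual SMOS is $X^{**}=(X^*)^*$. For a normed space $E$ with isometric involution and a cone $E_+\subseteq E_{\mathrm{sa}}$, the dual $E^*$ carries the involution $F^*(x)=\overline{F(x^*)}$ and the cone of self-adjoint $F\in E^*$ with $F\ge 0$ on $E_+$; applying this twice to $E=M_n(X)$ gives the bidual norm, involution and cone of $M_n(X)^{**}$. For $F\in M_n(X)^*$ let $\Theta^X_F\in M_n(X^*)$ be given by $(\Theta^X_F)_{kl}(x)=F(e^{k,l}\otimes x)$, where $e^{k,l}$ are the matrix units. For a normed space $Y$, $f\in M_n(Y^*)$ and $y\in M_n(Y)$ put $(f,y)=\sum_{k,l=1}^n f_{kl}(y_{kl})$, and let $\sigma(M_n(Y^*),M_n(Y))$ be the weakest topology on $M_n(Y^*)$ making all $f\mapsto(f,y)$ continuous. **Theorem.** Let $X$ be a SMOS and $n\in\mathbb N$. The map $$\Lambda:M_n(X^{**})\to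 M_n(X)^{**},\qquad \Lambda(z)(F)=(z,\Theta^X_F)\quad (z\in M_n(X^{**}),\ F\in M_n(X)^*)$$ is a surjective complex linear isometry and an order isomorphism, i.e. $\Lambda(z^*)=\Lambda(z)^*$, and $z\in M_n(X^{**})_+$ if and only if $\Lambda(z)\in (M_n(X)^{**})_+$. Moreover, $\Lambda$ preserves the canonical images of $M_n(X)$: if $\kappa_E:E\to E^{**}$ denotes the canonical embedding, then $\Lambda([\kappa_X(x_{kl})])=\kappa_{M_n(X)}(x)$ for all $x=[x_{kl}]\in M_n(X)$, so that $\Lambda$ maps the canonical image of $M_n(X)$ in $M_n(X^{**})$ onto the one in $M_n(X)^{**}$. Finally, $\Lambda$ is a homeomorphism for the topologies $\sigma(M_n(X^{**}),M_n(X^*))$ and $\sigma(M_n(X)^{**},M_n(X)^*)$. -/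

import Mathlib

noncomputable section

open scoped Matrix Kronecker

set_option linter.unusedSectionVars false

namespace OpSpace

section MatrixNorms

open scoped Matrix.Norms.L2Operator

variable {ι κ μ ν : Type*} [Fintype ι] [Fintype κ] [Fintype μ] [Fintype ν]
  [DecidableEq ι] [DecidableEq κ] [DecidableEq μ] [DecidableEq ν]

/-- Block-diagonal matrices as a star-homomorphism. -/
def blockHom : (Matrix μ μ ℂ × Matrix ν ν ℂ) →⋆ₐ[ℂ] Matrix (μ ⊕ ν) (μ ⊕ ν) ℂ where
  toFun p := Matrix.fromBlocks p.1 0 0 p.2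
  map_one' := by simp
  map_mul' p q := by simp [Matrix.fromBlocks_multiply]
  map_zero' := by simp
  map_add' p q := by simp [Matrix.fromBlocks_add]
  commutes' c := by
    simp [Algebra.algebraMap_eq_smul_one, Matrix.fromBlocks_smul, ← Matrix.fromBlocks_one]
  map_star' p := by simp [Matrix.star_eq_conjTranspose, Matrix.fromBlocks_conjTranspose]

theorem opNorm_fromBlocks_le (X : Matrix μ μ ℂ) (Y : Matrix ν ν ℂ) :
    ‖Matrix.fromBlocks X 0 0 Y‖ ≤ max ‖X‖ ‖Y‖ :=
  NonUnitalStarAlgHom.norm_apply_le (blockHom (μ := μ) (ν := ν)) (X, Y)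

/-- The map `M ↦ 1 ⊗ M` as a star-homomorphism. -/
def ampHom : Matrix μ μ ℂ →⋆ₐ[ℂ] Matrix (ι × μ) (ι × μ) ℂ where
  toFun M := (1 : Matrix ι ι ℂ) ⊗ₖ M
  map_one' := by simp
  map_mul' p q := by simp [← Matrix.mul_kronecker_mul]
  map_zero' := by simp
  map_add' p q := by simp [Matrix.kronecker_add]
  commutes' c := by simp [Algebra.algebraMap_eq_smul_one, Matrix.kronecker_smul]
  map_star' p := by simp [Matrix.star_eq_conjTranspose, Matrix.conjTranspose_kronecker]

theorem opNorm_one_kronecker_le (M : Matrix μ μ ℂ) :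
    ‖(1 : Matrix ι ι ℂ) ⊗ₖ M‖ ≤ ‖M‖ :=
  NonUnitalStarAlgHom.norm_apply_le (ampHom (ι := ι) (μ := μ)) M

theorem opNorm_eq_sqrt (B : Matrix μ ν ℂ) : ‖B‖ = Real.sqrt ‖Bᴴ * B‖ := by
  rw [Matrix.l2_opNorm_conjTranspose_mul_self, Real.sqrt_mul_self (norm_nonneg _)]

/-- The basic inequality for scalar matrices with the operator norm. -/
theorem opNorm_ruan (A : Matrix κ μ ℂ) (X : Matrix μ μ ℂ) (B : Matrix μ κ ℂ)
    (C : Matrix κ ν ℂ) (Y : Matrix ν ν ℂ) (D : Matrix ν κ ℂ) :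
    ‖A * X * B + C * Y * D‖ ≤
      Real.sqrt ‖A * Aᴴ + C * Cᴴ‖ * Real.sqrt ‖Bᴴ * B + Dᴴ * D‖ * max ‖X‖ ‖Y‖ := by
  have h : A * X * B + C * Y * D =
      Matrix.fromCols A C * Matrix.fromBlocks X 0 0 Y * Matrix.fromRows B D := by
    simp [Matrix.fromCols_mul_fromBlocks, Matrix.fromCols_mul_fromRows]
  have h1 : ‖Matrix.fromCols A C‖ = Real.sqrt ‖A * Aᴴ + C * Cᴴ‖ := by
    rw [← Matrix.l2_opNorm_conjTranspose, opNorm_eq_sqrt,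
      Matrix.conjTranspose_fromCols_eq_fromRows_conjTranspose,
      Matrix.conjTranspose_fromRows_eq_fromCols_conjTranspose, Matrix.fromCols_mul_fromRows]
    simp
  have h2 : ‖Matrix.fromRows B D‖ = Real.sqrt ‖Bᴴ * B + Dᴴ * D‖ := by
    rw [opNorm_eq_sqrt,
      Matrix.conjTranspose_fromRows_eq_fromCols_conjTranspose, Matrix.fromCols_mul_fromRows]
  rw [h, ← h1, ← h2]
  calc _ ≤ ‖Matrix.fromCols A C * Matrix.fromBlocks X 0 0 Y‖ * ‖Matrix.fromRows B D‖ :=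
        Matrix.l2_opNorm_mul _ _
    _ ≤ (‖Matrix.fromCols A C‖ * ‖Matrix.fromBlocks X 0 0 Y‖) * ‖Matrix.fromRows B D‖ := by
        gcongr; exact Matrix.l2_opNorm_mul _ _
    _ ≤ (‖Matrix.fromCols A C‖ * max ‖X‖ ‖Y‖) * ‖Matrix.fromRows B D‖ := by
        gcongr; exact opNorm_fromBlocks_le _ _
    _ = _ := by ring

theorem opNorm_unique [Unique ι] (M : Matrix ι ι ℂ) : ‖M‖ = ‖M default default‖ := by
  have : M = Matrix.diagonal (fun i => M i i) := by
    ext i j; simp [Subsingleton.elim i j]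
  conv_lhs => rw [this, Matrix.l2_opNorm_diagonal]
  simp [Pi.norm_def]

theorem opNorm_col (v : EuclideanSpace ℂ μ) :
    ‖(Matrix.of fun (i : μ) (_ : Fin 1) => v i)‖ = ‖v‖ := by
  rw [opNorm_eq_sqrt, opNorm_unique, EuclideanSpace.norm_eq]
  congr 1
  simp only [Matrix.mul_apply, Matrix.conjTranspose_apply, Matrix.of_apply, RCLike.star_def,
    RCLike.conj_mul]
  norm_cast
  exact abs_of_nonneg (by positivity)

theorem opNorm_le_of_bilin (M : Matrix μ μ ℂ) (c : ℝ) (hc : 0 ≤ c)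
    (h : ∀ (a : Matrix (Fin 1) μ ℂ) (b : Matrix μ (Fin 1) ℂ),
      ‖a * M * b‖ ≤ c * ‖a‖ * ‖b‖) : ‖M‖ ≤ c := by
  rw [Matrix.l2_opNorm_def]
  refine ContinuousLinearMap.opNorm_le_bound _ hc fun v => ?_
  set b : Matrix μ (Fin 1) ℂ := Matrix.of fun i _ => v i with hb
  set w : EuclideanSpace ℂ μ := WithLp.toLp 2 (M *ᵥ v.ofLp) with hw
  have e : M * b = Matrix.of fun i _ => w i := by
    ext i j
    simp [hb, hw, Matrix.mul_apply, Matrix.mulVec, dotProduct]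
  have h1 := h (M * b)ᴴ b
  rw [Matrix.mul_assoc, Matrix.l2_opNorm_conjTranspose_mul_self, Matrix.l2_opNorm_conjTranspose,
    e, opNorm_col, hb, opNorm_col] at h1
  change ‖w‖ ≤ c * ‖v‖
  by_cases hz : ‖w‖ = 0
  · rw [hz]; positivity
  · have : 0 < ‖w‖ := lt_of_le_of_ne (norm_nonneg _) (Ne.symm hz)
    nlinarith

open scoped MatrixOrder ComplexOrder in
theorem isClosed_posSemidef : IsClosed {M : Matrix μ μ ℂ | M.PosSemidef} := by
  have := CStarAlgebra.isClosed_nonneg (A := Matrix μ μ ℂ)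
  simpa only [Matrix.nonneg_iff_posSemidef] using this

end MatrixNorms

section Amplification

variable {X : Type*} [NormedAddCommGroup X] [NormedSpace ℂ X]

/-- The bimodule action of scalar matrices on matrices over `X`: the product `a x b`. -/
def lr {k m m' k' : Type*} [Fintype m] [Fintype m'] (a : Matrix k m ℂ) (x : Matrix m m' X)
    (b : Matrix m' k' ℂ) : Matrix k k' X :=
  Matrix.of fun i j => ∑ p, ∑ q, (a i p * b q j) • x p q

/-- The involution on matrices induced by a conjugate-linear map: `(x⋆)ᵢⱼ = (xⱼᵢ)⋆`. -/
def matStar (J : X →L⋆[ℂ] X) {n : ℕ} (x : Matrix (Fin n) (Fin n) X) :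
    Matrix (Fin n) (Fin n) X :=
  Matrix.of fun i j => J (x j i)

/-- A matrix `f` of functionals is regarded as the map `X → Mₙ`, `x ↦ [f k l x]`. Its `m`-th
amplification `f⁽ᵐ⁾ : M_m(X) → M_m(M_n)` sends `[x i j]` to the matrix with blocks `f (x i j)`;
`M_m(M_n)` is the algebra of matrices indexed by `Fin m × Fin n`. -/
def amp {m n : ℕ} (f : Matrix (Fin n) (Fin n) (StrongDual ℂ X)) (x : Matrix (Fin m) (Fin m) X) :
    Matrix (Fin m × Fin n) (Fin m × Fin n) ℂ :=
  Matrix.of fun s t => f s.2 t.2 (x s.1 t.1)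

/-- The pairing `(f, x) = ∑ f k l (x k l)` between `Mₙ(X*)` and `Mₙ(X)`. -/
def pairing {n : ℕ} (f : Matrix (Fin n) (Fin n) (StrongDual ℂ X))
    (x : Matrix (Fin n) (Fin n) X) : ℂ :=
  ∑ k, ∑ l, f k l (x k l)

/-- The involution `f⋆(x) = conj (f (x⋆))` on the dual of a space with involution `J`. -/
def dualStar (J : X →L⋆[ℂ] X) : StrongDual ℂ X →L⋆[ℂ] StrongDual ℂ X :=
  LinearMap.mkContinuous
    { toFun := fun f => ((starL ℂ : ℂ ≃L⋆[ℂ] ℂ) : ℂ →L⋆[ℂ] ℂ).comp (f.comp J)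
      map_add' := fun f g => by ext x; simp
      map_smul' := fun c f => by ext x; simp } ‖J‖ fun f => by
    refine ContinuousLinearMap.opNorm_le_bound _ (by positivity) fun x => ?_
    simp only [LinearMap.coe_mk, AddHom.coe_mk, ContinuousLinearMap.comp_apply]
    calc ‖star (f (J x))‖ = ‖f (J x)‖ := norm_star _
      _ ≤ ‖f‖ * (‖J‖ * ‖x‖) := f.le_opNorm_of_le (J.le_opNorm x)
      _ = _ := by ring

@[simp]
theorem dualStar_apply (J : X →L⋆[ℂ] X) (f : StrongDual ℂ X) (x : X) :
    dualStar J f x = star (f (J x)) := rfl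

/-- The dual cone: self-adjoint bounded functionals that are nonnegative on `C`. -/
def dualCone (J : X →L⋆[ℂ] X) (C : Set X) : Set (StrongDual ℂ X) :=
  {f | dualStar J f = f ∧ ∀ x ∈ C, 0 ≤ (f x).re}

end Amplification

open scoped Matrix.Norms.L2Operator in
/-- A semi-matrix ordered operator space structure on a complex normed space `X` (not assumed
complete): a conjugate-linear involution, an operator space matrix norm `‖·‖ₙ` on the matrix
spaces `Mₙ(X)` whose first level is the norm of `X` and for which the induced involutions are
isometric, and norm closed matrix cones `Mₙ(X)₊` of self-adjoint elements (neither proper nor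
generating). Scalar matrices carry the operator norm. The union `M_∞(X)` of the spaces `Mₙ(X)`
is described through its levels, which is why the scalar matrices in the axioms are rectangular.
Continuity of the involution is automatic from `mnorm_star`. -/
structure SMOS (X : Type*) [NormedAddCommGroup X] [NormedSpace ℂ X] where
  /-- the involution of `X` -/
  adj : X →L⋆[ℂ] X
  adj_adj : ∀ x, adj (adj x) = x
  /-- the norm of `Mₙ(X)` -/
  mnorm : ∀ n : ℕ, Seminorm ℂ (Matrix (Fin n) (Fin n) X)
  mnorm_definite : ∀ (n : ℕ) (x : Matrix (Fin n) (Fin n) X), mnorm n x = 0 → x = 0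
  mnorm_one : ∀ x : X, mnorm 1 (Matrix.of fun _ _ => x) = ‖x‖
  mnorm_ruan : ∀ (k m n : ℕ) (a : Matrix (Fin k) (Fin m) ℂ) (x : Matrix (Fin m) (Fin m) X)
    (b : Matrix (Fin m) (Fin k) ℂ) (c : Matrix (Fin k) (Fin n) ℂ)
    (y : Matrix (Fin n) (Fin n) X) (d : Matrix (Fin n) (Fin k) ℂ),
    mnorm k (lr a x b + lr c y d) ≤
      Real.sqrt ‖a * aᴴ + c * cᴴ‖ * Real.sqrt ‖bᴴ * b + dᴴ * d‖ * max (mnorm m x) (mnorm n y)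
  mnorm_star : ∀ (n : ℕ) (x : Matrix (Fin n) (Fin n) X), mnorm n (matStar adj x) = mnorm n x
  /-- the cone `Mₙ(X)₊` -/
  cone : ∀ n : ℕ, Set (Matrix (Fin n) (Fin n) X)
  cone_star : ∀ (n : ℕ), ∀ x ∈ cone n, matStar adj x = x
  cone_compress : ∀ (k m n : ℕ) (a : Matrix (Fin m) (Fin k) ℂ) (b : Matrix (Fin n) (Fin k) ℂ),
    ∀ x ∈ cone m, ∀ y ∈ cone n, lr aᴴ x a + lr bᴴ y b ∈ cone k
  cone_closed : ∀ (n : ℕ) (x : Matrix (Fin n) (Fin n) X),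
    (∀ ε : ℝ, 0 < ε → ∃ y ∈ cone n, mnorm n (x - y) < ε) → x ∈ cone n

namespace SMOS

variable {X : Type*} [NormedAddCommGroup X] [NormedSpace ℂ X] (S : SMOS X)

/-- `Mₙ(X)` with the norm of the operator space `X`. -/
def Mat (_ : SMOS X) (n : ℕ) : Type _ := Matrix (Fin n) (Fin n) X

instance (n : ℕ) : AddCommGroup (S.Mat n) :=
  inferInstanceAs (AddCommGroup (Matrix (Fin n) (Fin n) X))

instance (n : ℕ) : Module ℂ (S.Mat n) :=
  inferInstanceAs (Module ℂ (Matrix (Fin n) (Fin n) X))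

instance (n : ℕ) : Norm (S.Mat n) := ⟨fun x => S.mnorm n x⟩

theorem mat_core (n : ℕ) : NormedSpace.Core ℂ (S.Mat n) where
  norm_nonneg x := apply_nonneg (S.mnorm n) x
  norm_smul c x := map_smul_eq_mul (S.mnorm n) c x
  norm_triangle x y := map_add_le_add (S.mnorm n) x y
  norm_eq_zero_iff x := ⟨S.mnorm_definite n x, fun h => by rw [h]; exact map_zero (S.mnorm n)⟩

instance (n : ℕ) : NormedAddCommGroup (S.Mat n) := NormedAddCommGroup.ofCore (S.mat_core n)

instance (n : ℕ) : NormedSpace ℂ (S.Mat n) := NormedSpace.ofCore (S.mat_core n)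

/-- The involution of `Mₙ(X)`. -/
def starMat (n : ℕ) : S.Mat n →L⋆[ℂ] S.Mat n :=
  LinearMap.mkContinuous
    { toFun := fun x => (matStar S.adj x : Matrix (Fin n) (Fin n) X)
      map_add' := fun x y => by
        refine Matrix.ext fun i j => ?_
        exact map_add S.adj (x j i) (y j i)
      map_smul' := fun c x => by
        refine Matrix.ext fun i j => ?_
        exact map_smulₛₗ S.adj c (x j i) } 1 fun x => by
    rw [one_mul]; exact (S.mnorm_star n x).le

section
open scoped Matrix.Norms.L2Operator

theorem mnorm_lr_le {k m : ℕ} (a : Matrix (Fin k) (Fin m) ℂ) (x : Matrix (Fin m) (Fin m) X)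
    (b : Matrix (Fin m) (Fin k) ℂ) : S.mnorm k (lr a x b) ≤ ‖a‖ * ‖b‖ * S.mnorm m x := by
  have h := S.mnorm_ruan k m m a x b 0 x 0
  have e : lr (0 : Matrix (Fin k) (Fin m) ℂ) x (0 : Matrix (Fin m) (Fin k) ℂ) = 0 := by
    ext i j; simp [lr]
  rw [e] at h
  simp only [add_zero, Matrix.zero_mul, Matrix.conjTranspose_zero, max_self] at h
  rw [← opNorm_eq_sqrt b] at h
  have h2 := opNorm_eq_sqrt aᴴ
  rw [Matrix.conjTranspose_conjTranspose, Matrix.l2_opNorm_conjTranspose] at h2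
  rwa [← h2] at h

theorem norm_map_le {m : ℕ} (φ : StrongDual ℂ X) (x : Matrix (Fin m) (Fin m) X) :
    ‖x.map φ‖ ≤ ‖φ‖ * S.mnorm m x := by
  refine opNorm_le_of_bilin _ _ (mul_nonneg (norm_nonneg _) (apply_nonneg _ _)) fun a b => ?_
  have e : (a * x.map φ * b) default default = φ (lr a x b 0 0) := by
    simp only [Matrix.mul_apply, Matrix.map_apply, lr, Matrix.of_apply, map_sum, map_smul,
      smul_eq_mul, Finset.sum_mul]
    rw [Finset.sum_comm]
    refine Finset.sum_congr rfl fun i _ => Finset.sum_congr rfl fun j _ => ?_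
    simp only [Fin.default_eq_zero]
    ring
  have e2 : lr a x b = Matrix.of fun _ _ => lr a x b 0 0 := by
    ext i j; rw [Subsingleton.elim i 0, Subsingleton.elim j 0]; rfl
  rw [opNorm_unique, e]
  calc ‖φ (lr a x b 0 0)‖ ≤ ‖φ‖ * ‖lr a x b 0 0‖ := φ.le_opNorm _
    _ = ‖φ‖ * S.mnorm 1 (lr a x b) := by rw [← S.mnorm_one, ← e2]
    _ ≤ ‖φ‖ * (‖a‖ * ‖b‖ * S.mnorm m x) := by gcongr; exact S.mnorm_lr_le a x b
    _ = _ := by ring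

/-- The isometry `ξ ↦ ξ ⊗ e_k`. -/
def colIso (m : ℕ) {n : ℕ} (k : Fin n) : Matrix (Fin m × Fin n) (Fin m) ℂ :=
  Matrix.of fun s i => if s.1 = i ∧ s.2 = k then 1 else 0

theorem norm_colIso_le (m : ℕ) {n : ℕ} (k : Fin n) : ‖colIso m k‖ ≤ 1 := by
  have h : (colIso m k)ᴴ * colIso m k = 1 := by
    ext i j
    simp [colIso, Matrix.mul_apply, Fintype.sum_prod_type, Matrix.one_apply, ite_and,
      apply_ite star, eq_comm]
  rw [opNorm_eq_sqrt, h]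
  refine Real.sqrt_le_one.mpr ?_
  rw [← Matrix.diagonal_one, Matrix.l2_opNorm_diagonal]
  exact (pi_norm_le_iff_of_nonneg zero_le_one).mpr fun _ => by simp

theorem amp_eq_sum {m n : ℕ} (f : Matrix (Fin n) (Fin n) (StrongDual ℂ X))
    (x : Matrix (Fin m) (Fin m) X) :
    amp f x = ∑ k, ∑ l, colIso m k * x.map (f k l) * (colIso m l)ᴴ := by
  ext s t
  simp [amp, colIso, Matrix.sum_apply, Matrix.mul_apply, ite_and, apply_ite star]

theorem norm_amp_le_sum {m n : ℕ} (f : Matrix (Fin n) (Fin n) (StrongDual ℂ X))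
    (x : Matrix (Fin m) (Fin m) X) :
    ‖amp f x‖ ≤ (∑ k, ∑ l, ‖f k l‖) * S.mnorm m x := by
  rw [amp_eq_sum, Finset.sum_mul]
  refine (norm_sum_le _ _).trans (Finset.sum_le_sum fun k _ => ?_)
  rw [Finset.sum_mul]
  refine (norm_sum_le _ _).trans (Finset.sum_le_sum fun l _ => ?_)
  have hc : ‖(colIso m l)ᴴ‖ ≤ 1 := by
    rw [Matrix.l2_opNorm_conjTranspose]; exact norm_colIso_le m l
  calc ‖colIso m k * x.map (f k l) * (colIso m l)ᴴ‖
      ≤ ‖colIso m k * x.map (f k l)‖ * ‖(colIso m l)ᴴ‖ := Matrix.l2_opNorm_mul _ _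
    _ ≤ (‖colIso m k‖ * ‖x.map (f k l)‖) * ‖(colIso m l)ᴴ‖ := by
        gcongr; exact Matrix.l2_opNorm_mul _ _
    _ ≤ (1 * ‖x.map (f k l)‖) * 1 := by
        gcongr; exact norm_colIso_le m k
    _ = ‖x.map (f k l)‖ := by ring
    _ ≤ _ := S.norm_map_le _ _

/-- The completely bounded norm of `f ∈ Mₙ(X*) = CB(X, Mₙ)`: the supremum of the operator norms
`‖f⁽ᵐ⁾(x)‖` over all `m` and all `x` in the closed unit ball of `M_m(X)`. -/
def cbNorm {n : ℕ} (f : Matrix (Fin n) (Fin n) (StrongDual ℂ X)) : ℝ :=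
  sSup {r : ℝ | ∃ (m : ℕ) (x : Matrix (Fin m) (Fin m) X), S.mnorm m x ≤ 1 ∧ r = ‖amp f x‖}

theorem cbNorm_bddAbove {n : ℕ} (f : Matrix (Fin n) (Fin n) (StrongDual ℂ X)) :
    BddAbove {r : ℝ | ∃ (m : ℕ) (x : Matrix (Fin m) (Fin m) X),
      S.mnorm m x ≤ 1 ∧ r = ‖amp f x‖} := by
  refine ⟨∑ k, ∑ l, ‖f k l‖, ?_⟩
  rintro r ⟨m, x, hx, rfl⟩
  exact (S.norm_amp_le_sum f x).trans (mul_le_of_le_one_right (by positivity) hx)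

theorem amp_smul_right {m n : ℕ} (f : Matrix (Fin n) (Fin n) (StrongDual ℂ X)) (c : ℂ)
    (x : Matrix (Fin m) (Fin m) X) : amp f (c • x) = c • amp f x := by
  ext s t; simp [amp]

theorem cbNorm_nonneg {n : ℕ} (f : Matrix (Fin n) (Fin n) (StrongDual ℂ X)) : 0 ≤ S.cbNorm f :=
  Real.sSup_nonneg (by rintro r ⟨m, x, -, rfl⟩; exact norm_nonneg _)

theorem norm_amp_le {m n : ℕ} (f : Matrix (Fin n) (Fin n) (StrongDual ℂ X))
    (x : Matrix (Fin m) (Fin m) X) : ‖amp f x‖ ≤ S.cbNorm f * S.mnorm m x := by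
  by_cases h : S.mnorm m x = 0
  · have := S.norm_amp_le_sum f x
    simpa [h] using this
  · have hp : 0 < S.mnorm m x := lt_of_le_of_ne (apply_nonneg _ _) (Ne.symm h)
    have h1 : ‖amp f (((S.mnorm m x : ℂ))⁻¹ • x)‖ ≤ S.cbNorm f := by
      refine le_csSup (S.cbNorm_bddAbove f) ⟨m, _, ?_, rfl⟩
      rw [map_smul_eq_mul, norm_inv, Complex.norm_real, Real.norm_of_nonneg hp.le,
        inv_mul_cancel₀ h]
    rw [amp_smul_right, norm_smul, norm_inv, Complex.norm_real, Real.norm_of_nonneg hp.le,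
      inv_mul_le_iff₀ hp] at h1
    linarith [mul_comm (S.mnorm m x) (S.cbNorm f)]

theorem cbNorm_le {n : ℕ} (f : Matrix (Fin n) (Fin n) (StrongDual ℂ X)) (c : ℝ) (hc : 0 ≤ c)
    (h : ∀ (m : ℕ) (x : Matrix (Fin m) (Fin m) X), ‖amp f x‖ ≤ c * S.mnorm m x) :
    S.cbNorm f ≤ c := by
  refine Real.sSup_le ?_ hc
  rintro r ⟨m, x, hx, rfl⟩
  exact (h m x).trans (mul_le_of_le_one_right hc hx)

theorem amp_add {m n : ℕ} (f g : Matrix (Fin n) (Fin n) (StrongDual ℂ X))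
    (x : Matrix (Fin m) (Fin m) X) : amp (f + g) x = amp f x + amp g x := by
  ext s t; simp [amp]

theorem amp_sub {m n : ℕ} (f g : Matrix (Fin n) (Fin n) (StrongDual ℂ X))
    (x : Matrix (Fin m) (Fin m) X) : amp (f - g) x = amp f x - amp g x := by
  ext s t; simp [amp]

theorem amp_smul {m n : ℕ} (c : ℂ) (f : Matrix (Fin n) (Fin n) (StrongDual ℂ X))
    (x : Matrix (Fin m) (Fin m) X) : amp (c • f) x = c • amp f x := by
  ext s t; simp [amp]

theorem amp_lr {m n k : ℕ} (a : Matrix (Fin k) (Fin n) ℂ)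
    (f : Matrix (Fin n) (Fin n) (StrongDual ℂ X)) (b : Matrix (Fin n) (Fin k) ℂ)
    (x : Matrix (Fin m) (Fin m) X) :
    amp (lr a f b) x =
      ((1 : Matrix (Fin m) (Fin m) ℂ) ⊗ₖ a) * amp f x * ((1 : Matrix (Fin m) (Fin m) ℂ) ⊗ₖ b) := by
  ext s t
  simp only [amp, lr, Matrix.of_apply, Matrix.mul_apply, Matrix.kroneckerMap_apply,
    Fintype.sum_prod_type, Matrix.one_apply, ite_mul, one_mul, zero_mul, Finset.sum_ite_irrel,
    Finset.sum_const_zero, Finset.sum_ite_eq, Finset.mem_univ, if_true, mul_ite, mul_zero,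
    Finset.sum_ite_eq', Finset.sum_mul, _root_.sum_apply,
    _root_.smul_apply, smul_eq_mul]
  rw [Finset.sum_comm]
  refine Finset.sum_congr rfl fun i _ => Finset.sum_congr rfl fun j _ => ?_
  ring

theorem amp_matStar {m n : ℕ} (f : Matrix (Fin n) (Fin n) (StrongDual ℂ X))
    (x : Matrix (Fin m) (Fin m) X) :
    amp (matStar (dualStar S.adj) f) x = (amp f (matStar S.adj x))ᴴ := by
  ext s t; simp [amp, matStar]

theorem dualStar_dualStar (f : StrongDual ℂ X) :
    dualStar S.adj (dualStar S.adj f) = f := by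
  ext x; simp [S.adj_adj]

theorem cbNorm_matStar_le {n : ℕ} (f : Matrix (Fin n) (Fin n) (StrongDual ℂ X)) :
    S.cbNorm (matStar (dualStar S.adj) f) ≤ S.cbNorm f := by
  refine S.cbNorm_le _ _ (S.cbNorm_nonneg f) fun m x => ?_
  rw [S.amp_matStar, Matrix.l2_opNorm_conjTranspose, ← S.mnorm_star]
  exact S.norm_amp_le _ _

theorem matStar_matStar_dual {n : ℕ} (f : Matrix (Fin n) (Fin n) (StrongDual ℂ X)) :
    matStar (dualStar S.adj) (matStar (dualStar S.adj) f) = f := by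
  refine Matrix.ext fun i j => ?_
  exact S.dualStar_dualStar (f i j)

theorem cbNorm_matStar {n : ℕ} (f : Matrix (Fin n) (Fin n) (StrongDual ℂ X)) :
    S.cbNorm (matStar (dualStar S.adj) f) = S.cbNorm f :=
  le_antisymm (S.cbNorm_matStar_le f) (by
    conv_lhs => rw [← S.matStar_matStar_dual f]
    exact S.cbNorm_matStar_le _)

theorem cbNorm_zero (n : ℕ) : S.cbNorm (0 : Matrix (Fin n) (Fin n) (StrongDual ℂ X)) = 0 := by
  refine le_antisymm (S.cbNorm_le _ 0 le_rfl fun m x => ?_) (S.cbNorm_nonneg _)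
  have : amp (0 : Matrix (Fin n) (Fin n) (StrongDual ℂ X)) x = 0 := by ext s t; simp [amp]
  simp [this]

/-- The dual matrix norm as a seminorm on `Mₙ(X*)`. -/
def dualNorm (n : ℕ) : Seminorm ℂ (Matrix (Fin n) (Fin n) (StrongDual ℂ X)) :=
  Seminorm.ofSMulLE (𝕜 := ℂ) S.cbNorm
    (S.cbNorm_zero n)
    (fun f g => S.cbNorm_le _ _ (add_nonneg (S.cbNorm_nonneg f) (S.cbNorm_nonneg g)) fun m x => by
      rw [amp_add, add_mul]
      exact (norm_add_le _ _).trans (add_le_add (S.norm_amp_le f x) (S.norm_amp_le g x)))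
    (fun (c : ℂ) f => S.cbNorm_le _ _ (mul_nonneg (norm_nonneg c) (S.cbNorm_nonneg f)) fun m x => by
      rw [amp_smul, norm_smul, mul_assoc]
      exact mul_le_mul_of_nonneg_left (S.norm_amp_le f x) (norm_nonneg c))

theorem dualNorm_apply {n : ℕ} (f : Matrix (Fin n) (Fin n) (StrongDual ℂ X)) :
    S.dualNorm n f = S.cbNorm f := rfl

open scoped ComplexOrder

/-- The dual matrix cone: `f ∈ Mₙ(X*)` is positive when, as a map `X → Mₙ`, it is self-adjoint
and completely positive. -/
def dualMatCone (n : ℕ) : Set (Matrix (Fin n) (Fin n) (StrongDual ℂ X)) :=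
  {f | matStar (dualStar S.adj) f = f ∧
    ∀ (m : ℕ), ∀ x ∈ S.cone m, (amp f x).PosSemidef}

theorem cbNorm_definite {n : ℕ} (f : Matrix (Fin n) (Fin n) (StrongDual ℂ X))
    (h : S.cbNorm f = 0) : f = 0 := by
  refine Matrix.ext fun k l => ContinuousLinearMap.ext fun x => ?_
  have h1 := S.norm_amp_le f (Matrix.of fun (_ _ : Fin 1) => x)
  rw [h, zero_mul] at h1
  have h2 : amp f (Matrix.of fun (_ _ : Fin 1) => x) = 0 :=
    norm_eq_zero.mp (le_antisymm h1 (norm_nonneg _))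
  exact congrFun (congrFun h2 ((0 : Fin 1), k)) ((0 : Fin 1), l)

theorem cbNorm_one (φ : StrongDual ℂ X) :
    S.cbNorm (Matrix.of fun (_ _ : Fin 1) => φ) = ‖φ‖ := by
  refine le_antisymm (S.cbNorm_le _ _ (norm_nonneg _) fun m x => ?_) ?_
  · simpa using S.norm_amp_le_sum (Matrix.of fun (_ _ : Fin 1) => φ) x
  · refine φ.opNorm_le_bound (S.cbNorm_nonneg _) fun x => ?_
    have h := S.norm_amp_le (Matrix.of fun (_ _ : Fin 1) => φ) (Matrix.of fun (_ _ : Fin 1) => x)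
    rw [S.mnorm_one] at h
    let _ : Unique (Fin 1 × Fin 1) := Unique.mk' _
    rwa [opNorm_unique] at h

theorem cbNorm_ruan {k m n : ℕ} (a : Matrix (Fin k) (Fin m) ℂ)
    (f : Matrix (Fin m) (Fin m) (StrongDual ℂ X)) (b : Matrix (Fin m) (Fin k) ℂ)
    (c : Matrix (Fin k) (Fin n) ℂ) (g : Matrix (Fin n) (Fin n) (StrongDual ℂ X))
    (d : Matrix (Fin n) (Fin k) ℂ) :
    S.cbNorm (lr a f b + lr c g d) ≤
      Real.sqrt ‖a * aᴴ + c * cᴴ‖ * Real.sqrt ‖bᴴ * b + dᴴ * d‖ *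
        max (S.cbNorm f) (S.cbNorm g) := by
  refine S.cbNorm_le _ _ (mul_nonneg (by positivity)
    (le_max_of_le_left (S.cbNorm_nonneg f))) fun p x => ?_
  rw [amp_add, amp_lr, amp_lr]
  refine (opNorm_ruan _ _ _ _ _ _).trans ?_
  simp only [Matrix.conjTranspose_kronecker, Matrix.conjTranspose_one, ← Matrix.mul_kronecker_mul,
    Matrix.mul_one, ← Matrix.kronecker_add]
  rw [mul_assoc _ (max _ _) _, max_mul_of_nonneg _ _ (apply_nonneg _ _)]
  gcongr
  · exact opNorm_one_kronecker_le _
  · exact opNorm_one_kronecker_le _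
  · exact S.norm_amp_le f x
  · exact S.norm_amp_le g x

theorem matStar_lr {k m : ℕ} (a : Matrix (Fin m) (Fin k) ℂ)
    (f : Matrix (Fin m) (Fin m) (StrongDual ℂ X)) :
    matStar (dualStar S.adj) (lr aᴴ f a) = lr aᴴ (matStar (dualStar S.adj) f) a := by
  refine Matrix.ext fun i j => ?_
  simp only [matStar, lr, Matrix.of_apply, map_sum, map_smulₛₗ]
  rw [Finset.sum_comm]
  refine Finset.sum_congr rfl fun p _ => Finset.sum_congr rfl fun q _ => ?_
  simp [mul_comm]

theorem dualMatCone_compress {k m n : ℕ} (a : Matrix (Fin m) (Fin k) ℂ)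
    (b : Matrix (Fin n) (Fin k) ℂ) (f : Matrix (Fin m) (Fin m) (StrongDual ℂ X))
    (hf : f ∈ S.dualMatCone m) (g : Matrix (Fin n) (Fin n) (StrongDual ℂ X))
    (hg : g ∈ S.dualMatCone n) : lr aᴴ f a + lr bᴴ g b ∈ S.dualMatCone k := by
  refine ⟨?_, fun p x hx => ?_⟩
  · have : matStar (dualStar S.adj) (lr aᴴ f a + lr bᴴ g b) =
        matStar (dualStar S.adj) (lr aᴴ f a) + matStar (dualStar S.adj) (lr bᴴ g b) := by
      refine Matrix.ext fun i j => ?_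
      exact map_add (dualStar S.adj) _ _
    rw [this, S.matStar_lr, S.matStar_lr, hf.1, hg.1]
  · rw [amp_add, amp_lr, amp_lr]
    have e : ∀ (r : ℕ) (u : Matrix (Fin r) (Fin k) ℂ), (1 : Matrix (Fin p) (Fin p) ℂ) ⊗ₖ uᴴ =
        ((1 : Matrix (Fin p) (Fin p) ℂ) ⊗ₖ u)ᴴ := fun r u => by
      rw [Matrix.conjTranspose_kronecker, Matrix.conjTranspose_one]
    rw [e, e]
    exact ((hf.2 p x hx).conjTranspose_mul_mul_same _).add
      ((hg.2 p x hx).conjTranspose_mul_mul_same _)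

theorem dualMatCone_closed {n : ℕ} (f : Matrix (Fin n) (Fin n) (StrongDual ℂ X))
    (h : ∀ ε : ℝ, 0 < ε → ∃ g ∈ S.dualMatCone n, S.dualNorm n (f - g) < ε) : f ∈ S.dualMatCone n := by
  refine ⟨?_, fun m x hx => ?_⟩
  · rw [← sub_eq_zero]
    refine S.cbNorm_definite _ (le_antisymm (le_of_forall_pos_lt_add fun ε hε => ?_)
      (S.cbNorm_nonneg _))
    obtain ⟨g, hg, hfg⟩ := h (ε / 2) (half_pos hε)
    have e : matStar (dualStar S.adj) f - f = matStar (dualStar S.adj) (f - g) - (f - g) := by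
      have : matStar (dualStar S.adj) (f - g) = matStar (dualStar S.adj) f - g := by
        conv_rhs => rw [← hg.1]
        refine Matrix.ext fun i j => ?_
        exact map_sub (dualStar S.adj) _ _
      rw [this]; abel
    rw [e, ← S.dualNorm_apply]
    have h1 := map_sub_le_add (S.dualNorm n) (matStar (dualStar S.adj) (f - g)) (f - g)
    have h2 : S.dualNorm n (matStar (dualStar S.adj) (f - g)) = S.dualNorm n (f - g) :=
      S.cbNorm_matStar _
    linarith
  · refine isClosed_posSemidef.closure_subset (Metric.mem_closure_iff.mpr fun ε hε => ?_)
    have hp : 0 < S.mnorm m x + 1 := by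
      have := apply_nonneg (S.mnorm m) x
      linarith
    obtain ⟨g, hg, hfg⟩ := h (ε / (S.mnorm m x + 1)) (div_pos hε hp)
    refine ⟨amp g x, hg.2 m x hx, ?_⟩
    rw [dist_eq_norm, ← amp_sub]
    calc ‖amp (f - g) x‖ ≤ S.cbNorm (f - g) * S.mnorm m x := S.norm_amp_le _ _
      _ ≤ S.cbNorm (f - g) * (S.mnorm m x + 1) := by
          gcongr
          · exact S.cbNorm_nonneg _
          · linarith
      _ < ε := by rwa [S.dualNorm_apply, lt_div_iff₀ hp] at hfg

/-- The dual semi-matrix ordered operator space `X*`. -/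
def dual : SMOS (StrongDual ℂ X) where
  adj := dualStar S.adj
  adj_adj := S.dualStar_dualStar
  mnorm := S.dualNorm
  mnorm_definite _ f h := S.cbNorm_definite f h
  mnorm_one := S.cbNorm_one
  mnorm_ruan _ _ _ a f b c g d := S.cbNorm_ruan a f b c g d
  mnorm_star _ f := S.cbNorm_matStar f
  cone := S.dualMatCone
  cone_star _ _ hf := hf.1
  cone_compress _ _ _ a b f hf g hg := S.dualMatCone_compress a b f hf g hg
  cone_closed _ f h := S.dualMatCone_closed f h

/-- The map `x ↦ e_{kl} ⊗ x` from `X` to `Mₙ(X)`. -/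
def entry {n : ℕ} (k l : Fin n) : X →L[ℂ] S.Mat n :=
  LinearMap.mkContinuous
    { toFun := fun x => (Matrix.single k l x : Matrix (Fin n) (Fin n) X)
      map_add' := fun x y => Matrix.single_add k l x y
      map_smul' := fun c x => (Matrix.smul_single c k l x).symm }
    (‖(Matrix.of fun (i : Fin n) (_ : Fin 1) => if i = k then (1 : ℂ) else 0)‖ *
      ‖(Matrix.of fun (_ : Fin 1) (j : Fin n) => if l = j then (1 : ℂ) else 0)‖) fun x => by
    have h := S.mnorm_lr_le (Matrix.of fun (i : Fin n) (_ : Fin 1) => if i = k then (1 : ℂ) else 0)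
      (Matrix.of fun _ _ => x) (Matrix.of fun (_ : Fin 1) (j : Fin n) => if l = j then (1 : ℂ) else 0)
    rw [S.mnorm_one] at h
    refine le_trans (le_of_eq ?_) h
    change S.mnorm n (Matrix.single k l x) = _
    congr 1
    ext i j
    by_cases h1 : k = i <;> by_cases h2 : l = j <;>
      simp [lr, Matrix.single, h1, h2, eq_comm]

end

/-- The map `Θ : Mₙ(X)* → Mₙ(X*)`, `(Θ_F)ₖₗ(x) = F(e_{kl} ⊗ x)`. -/
def theta {n : ℕ} (F : StrongDual ℂ (S.Mat n)) : Matrix (Fin n) (Fin n) (StrongDual ℂ X) :=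
  Matrix.of fun k l => F.comp (S.entry k l)

/-- The canonical map `Mₙ(X) → Mₙ(X**)`, entrywise evaluation. -/
def kappa {n : ℕ} (x : S.Mat n) : S.dual.dual.Mat n :=
  Matrix.map x (NormedSpace.inclusionInDoubleDual ℂ X)

/-- The topology `σ(Mₙ(X*), Mₙ(X))`. -/
@[reducible]
def sigma (n : ℕ) : TopologicalSpace (S.dual.Mat n) :=
  TopologicalSpace.induced (fun f (x : Matrix (Fin n) (Fin n) X) => pairing f x)
    Pi.topologicalSpace

end SMOS

/-- The weak-star topology `σ(E*, E)` on the dual of a normed space. -/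
@[reducible]
def weakStar (E : Type*) [NormedAddCommGroup E] [NormedSpace ℂ E] :
    TopologicalSpace (StrongDual ℂ E) :=
  TopologicalSpace.induced (fun f (x : E) => f x) Pi.topologicalSpace

end OpSpace

end

/-!
The functionals on `Mₙ(X)` are exactly `x ↦ (f, x)` with `f ∈ Mₙ(X*)`, and `Θ` inverts this
correspondence (`ofPairing_theta`, `theta_ofPairing`). So `Λ` is a linear bijection which carries
the evaluations `z ↦ (z, f)` to the evaluations at functionals on `Mₙ(X)`, and this gives the claims
on the canonical images and on the weak topologies. The content is in the norms and the cones. Both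
rest on the identities `pairing_lr_left` and `pairing_lr_right`: the coefficients of the
amplification of `z` at `f ∈ M_m(X*)` are the numbers `(z, a f b)`, with the scalar matrices `a`, `b`
read as vectors.

Norm. The functional on `Mₙ(X)` defined by `a f b` has norm at most `‖f‖_cb ‖a‖₂ ‖b‖₂`
(`norm_ofPairing_lr_le`), so `‖z‖_cb ≤ ‖Λ(z)‖`. For the converse every functional `F` of norm one
must factor as `Θ_F = a f b` with `‖f‖_cb ‖a‖₂ ‖b‖₂` close to one (`exists_factorization`). To this
end the Hahn–Banach theorem in the finite-dimensional space `Mₙ × Mₙ × ℝ` provides positive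
functionals `φ`, `ψ` on `Mₙ`, of mass about one half, with `Re F(a x b) ≤ φ(a aᴴ) + ψ(bᴴ b)` for all
`x` in the unit ball of any `M_r(X)` (`exists_dominating_functionals`). Perturbed slightly, they are
`a aᴴ ↦ ‖C a‖₂²` and `bᴴ b ↦ ‖b D‖₂²` with invertible `C` and `D` (`exists_invertible_density`), and
dividing `F` by `C` and `D` leaves a completely bounded `f`. The perturbation costs an `ε`, which is
harmless for the norm estimate and spares the case of singular densities.

Order. The coefficients with `a = bᴴ` are the quadratic forms of the amplifications, and they are
values at compressions `bᴴ x b`, which stay in the matrix cone. Hence `F` is positive on `Mₙ(X)₊` if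
and only if `Θ_F` is completely positive (`theta_mem_cone`, `ofPairing_mem_dualCone`), and the same
argument one level higher gives the claim on the cones (`mem_cone_iff_bidualEquiv_mem`).
-/

noncomputable section

open scoped Matrix Kronecker

namespace OpSpace

/-! ### The scalar bimodule action and the pairing -/

section Pairing

variable {X : Type*} [NormedAddCommGroup X] [NormedSpace ℂ X]

theorem lr_lr {k m n n' m' k' : Type*} [Fintype m] [Fintype n] [Fintype n'] [Fintype m']
    (a : Matrix k m ℂ) (c : Matrix m n ℂ) (x : Matrix n n' X) (d : Matrix n' m' ℂ)
    (b : Matrix m' k' ℂ) : lr a (lr c x d) b = lr (a * c) x (d * b) := by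
  ext i j
  simp only [lr, Matrix.of_apply, Matrix.mul_apply, Finset.smul_sum, Finset.sum_smul, smul_smul,
    Finset.sum_mul_sum]
  calc _ = ∑ p, ∑ r, ∑ q, ∑ s, (a i p * b q j * (c p r * d s q)) • x r s :=
        Finset.sum_congr rfl fun p _ => Finset.sum_comm
    _ = ∑ r, ∑ p, ∑ s, ∑ q, (a i p * b q j * (c p r * d s q)) • x r s := by
        rw [Finset.sum_comm]
        exact Finset.sum_congr rfl fun r _ => Finset.sum_congr rfl fun p _ => Finset.sum_comm
    _ = ∑ r, ∑ s, ∑ p, ∑ q, (a i p * b q j * (c p r * d s q)) • x r s :=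
        Finset.sum_congr rfl fun r _ => Finset.sum_comm
    _ = _ := by
        refine Finset.sum_congr rfl fun r _ => Finset.sum_congr rfl fun s _ =>
          Finset.sum_congr rfl fun p _ => Finset.sum_congr rfl fun q _ => ?_
        congr 1; ring

theorem lr_one_one {m m' : Type*} [Fintype m] [Fintype m'] [DecidableEq m] [DecidableEq m']
    (x : Matrix m m' X) : lr 1 x 1 = x := by
  ext i j
  simp [lr, Matrix.one_apply]

theorem lr_add {k m m' k' : Type*} [Fintype m] [Fintype m'] (a : Matrix k m ℂ)
    (x y : Matrix m m' X) (b : Matrix m' k' ℂ) : lr a (x + y) b = lr a x b + lr a y b := by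
  ext i j
  simp [lr, Finset.sum_add_distrib]

theorem lr_smul_smul {k m m' k' : Type*} [Fintype m] [Fintype m'] (c d : ℂ) (a : Matrix k m ℂ)
    (x : Matrix m m' X) (b : Matrix m' k' ℂ) : lr (c • a) x (d • b) = (c * d) • lr a x b := by
  ext i j
  simp only [lr, Matrix.of_apply, Matrix.smul_apply, Finset.smul_sum, smul_smul, smul_eq_mul]
  refine Finset.sum_congr rfl fun p _ => Finset.sum_congr rfl fun q _ => ?_
  congr 1; ring

theorem lr_zero_left {k m m' k' : Type*} [Fintype m] [Fintype m']
    (x : Matrix m m' X) (b : Matrix m' k' ℂ) : lr (0 : Matrix k m ℂ) x b = 0 := by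
  ext i j
  simp [lr]

theorem lr_zero_right {k m m' k' : Type*} [Fintype m] [Fintype m'] (a : Matrix k m ℂ)
    (x : Matrix m m' X) : lr a x (0 : Matrix m' k' ℂ) = 0 := by
  ext i j
  simp [lr]

/-- The matrix `a : κ × μ`, read column by column as a row vector. The index order `μ × κ` is that
of the amplifications `amp`. -/
def rowVec {κ μ : Type*} (a : Matrix κ μ ℂ) : μ × κ → ℂ := fun s => a s.2 s.1

/-- The matrix `b : μ × κ`, read row by row as a column vector, indexed as the amplifications
`amp`. -/
def colVec {κ μ : Type*} (b : Matrix μ κ ℂ) : μ × κ → ℂ := fun s => b s.1 s.2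

/-- The quadratic forms of `f⁽ᵐ⁾(x)` are the values of `f` on the compressions `a x b`. -/
theorem pairing_lr_right {m n : ℕ} (f : Matrix (Fin n) (Fin n) (StrongDual ℂ X))
    (a : Matrix (Fin n) (Fin m) ℂ) (x : Matrix (Fin m) (Fin m) X) (b : Matrix (Fin m) (Fin n) ℂ) :
    pairing f (lr a x b) = rowVec a ⬝ᵥ (amp f x *ᵥ colVec b) := by
  simp only [pairing, lr, Matrix.of_apply, map_sum, map_smul, smul_eq_mul, dotProduct,
    Matrix.mulVec, rowVec, colVec, amp, Fintype.sum_prod_type, Finset.mul_sum]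
  calc _ = ∑ k, ∑ p, ∑ l, ∑ q, a k p * b q l * f k l (x p q) :=
        Finset.sum_congr rfl fun p _ => Finset.sum_comm
    _ = ∑ p, ∑ k, ∑ q, ∑ l, a k p * b q l * f k l (x p q) := by
        rw [Finset.sum_comm]
        exact Finset.sum_congr rfl fun r _ => Finset.sum_congr rfl fun p _ => Finset.sum_comm
    _ = _ := by
        refine Finset.sum_congr rfl fun r _ => Finset.sum_congr rfl fun s _ =>
          Finset.sum_congr rfl fun p _ => Finset.sum_congr rfl fun q _ => ?_
        ring

theorem pairing_lr_left {m n : ℕ} (a : Matrix (Fin n) (Fin m) ℂ)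
    (f : Matrix (Fin m) (Fin m) (StrongDual ℂ X)) (b : Matrix (Fin m) (Fin n) ℂ)
    (x : Matrix (Fin n) (Fin n) X) :
    pairing (lr a f b) x = pairing f (lr aᵀ x bᵀ) := by
  simp only [pairing, lr, Matrix.of_apply, map_sum, map_smul, smul_eq_mul, _root_.sum_apply,
    _root_.smul_apply, Matrix.transpose_apply]
  calc _ = ∑ k, ∑ p, ∑ l, ∑ q, a k p * b q l * f p q (x k l) :=
        Finset.sum_congr rfl fun p _ => Finset.sum_comm
    _ = ∑ p, ∑ k, ∑ q, ∑ l, a k p * b q l * f p q (x k l) := by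
        rw [Finset.sum_comm]
        exact Finset.sum_congr rfl fun r _ => Finset.sum_congr rfl fun p _ => Finset.sum_comm
    _ = _ := Finset.sum_congr rfl fun r _ => Finset.sum_comm

end Pairing

/-! ### The Hilbert–Schmidt norm and the operator norm -/

section HilbertSchmidt

open scoped Matrix.Norms.L2Operator

/-- The Hilbert–Schmidt norm of a rectangular scalar matrix. It is not taken from Mathlib's Frobenius
norm, whose instance would compete with the operator norm on scalar matrices. -/
def hs {κ μ : Type*} [Fintype κ] [Fintype μ] (a : Matrix κ μ ℂ) : ℝ :=
  Real.sqrt (∑ i, ∑ j, ‖a i j‖ ^ 2)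

variable {κ μ ν : Type*} [Fintype κ] [Fintype μ] [Fintype ν]

theorem hs_nonneg (a : Matrix κ μ ℂ) : 0 ≤ hs a := Real.sqrt_nonneg _

theorem hs_transpose (a : Matrix κ μ ℂ) : hs aᵀ = hs a := by
  rw [hs, hs, Finset.sum_comm]; rfl

theorem hs_conjTranspose (a : Matrix κ μ ℂ) : hs aᴴ = hs a := by
  rw [← hs_transpose a, hs, hs]; simp

theorem hs_smul (c : ℂ) (a : Matrix κ μ ℂ) : hs (c • a) = ‖c‖ * hs a := by
  simp only [hs, Matrix.smul_apply, norm_smul, mul_pow, ← Finset.mul_sum]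
  rw [Real.sqrt_mul (by positivity), Real.sqrt_sq (norm_nonneg c)]

theorem eq_zero_of_hs_eq_zero {a : Matrix κ μ ℂ} (h : hs a = 0) : a = 0 := by
  rw [hs, Real.sqrt_eq_zero (by positivity)] at h
  ext i j
  rw [Finset.sum_eq_zero_iff_of_nonneg (fun _ _ => by positivity)] at h
  have h1 := h i (Finset.mem_univ i)
  rw [Finset.sum_eq_zero_iff_of_nonneg (fun _ _ => by positivity)] at h1
  simpa using h1 j (Finset.mem_univ j)

theorem hs_sq (a : Matrix κ μ ℂ) : hs a ^ 2 = (aᴴ * a).trace.re := by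
  rw [hs, Real.sq_sqrt (by positivity), Finset.sum_comm, Matrix.trace, Complex.re_sum]
  refine Finset.sum_congr rfl fun j _ => ?_
  rw [Matrix.diag_apply, Matrix.mul_apply, Complex.re_sum]
  refine Finset.sum_congr rfl fun i _ => ?_
  rw [Matrix.conjTranspose_apply, RCLike.star_def, ← Complex.normSq_eq_conj_mul_self,
    Complex.ofReal_re, Complex.normSq_eq_norm_sq]

theorem norm_rowVec (a : Matrix κ μ ℂ) : ‖WithLp.toLp 2 (rowVec a)‖ = hs a := by
  rw [EuclideanSpace.norm_eq, hs, Fintype.sum_prod_type, Finset.sum_comm]; rfl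

theorem norm_colVec (b : Matrix μ κ ℂ) : ‖WithLp.toLp 2 (colVec b)‖ = hs b := by
  rw [EuclideanSpace.norm_eq, hs, Fintype.sum_prod_type]; rfl

/-- Together with `opNorm_le_of_dotProduct`: the operator norm on `ℂ^μ ⊗ ℂ^κ` is the norm of the
bilinear form in two matrices with the Hilbert–Schmidt norm. -/
theorem norm_dotProduct_mulVec_le [DecidableEq μ] [DecidableEq κ]
    (M : Matrix (μ × κ) (μ × κ) ℂ) (a : Matrix κ μ ℂ) (b : Matrix μ κ ℂ) :
    ‖rowVec a ⬝ᵥ (M *ᵥ colVec b)‖ ≤ ‖M‖ * hs a * hs b := by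
  have h1 : ‖rowVec a ⬝ᵥ (M *ᵥ colVec b)‖ ≤
      ‖WithLp.toLp 2 (M *ᵥ colVec b)‖ * ‖WithLp.toLp 2 (star (rowVec a))‖ := by
    have := norm_inner_le_norm (𝕜 := ℂ) (WithLp.toLp 2 (star (rowVec a)))
      (WithLp.toLp 2 (M *ᵥ colVec b))
    rw [EuclideanSpace.inner_toLp_toLp, star_star, dotProduct_comm] at this
    linarith [mul_comm ‖WithLp.toLp 2 (M *ᵥ colVec b)‖ ‖WithLp.toLp 2 (star (rowVec a))‖]
  have h2 : ‖WithLp.toLp 2 (star (rowVec a))‖ = hs a := by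
    rw [← norm_rowVec, EuclideanSpace.norm_eq, EuclideanSpace.norm_eq]; simp
  have h3 := Matrix.l2_opNorm_mulVec M (WithLp.toLp 2 (colVec b))
  rw [norm_colVec] at h3
  rw [h2] at h1
  refine h1.trans ((mul_le_mul_of_nonneg_right h3 (hs_nonneg a)).trans_eq (by ring))

theorem opNorm_le_of_dotProduct [DecidableEq μ] [DecidableEq κ]
    (M : Matrix (μ × κ) (μ × κ) ℂ) (c : ℝ) (hc : 0 ≤ c)
    (h : ∀ (a : Matrix κ μ ℂ) (b : Matrix μ κ ℂ),
      ‖rowVec a ⬝ᵥ (M *ᵥ colVec b)‖ ≤ c * hs a * hs b) : ‖M‖ ≤ c := by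
  refine opNorm_le_of_bilin M c hc fun a b => ?_
  have h1 := h (Matrix.of fun k i => a 0 (i, k)) (Matrix.of fun i k => b (i, k) 0)
  have e : rowVec (Matrix.of fun k i => a 0 (i, k)) ⬝ᵥ
      (M *ᵥ colVec (Matrix.of fun i k => b (i, k) 0)) = (a * M * b) default default := by
    rw [Matrix.mul_assoc]; rfl
  have ea : hs (Matrix.of fun k i => a 0 (i, k)) = ‖a‖ := by
    rw [← Matrix.l2_opNorm_conjTranspose, ← norm_rowVec]
    have := opNorm_col (WithLp.toLp 2 (star (a 0)))
    rw [EuclideanSpace.norm_eq] at this ⊢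
    have e2 : aᴴ = Matrix.of fun i _ => (WithLp.toLp 2 (star (a 0))) i := by
      ext i j; rw [Subsingleton.elim j 0]; rfl
    rw [e2, this]; simp [rowVec]
  have eb : hs (Matrix.of fun i k => b (i, k) 0) = ‖b‖ := by
    rw [← norm_colVec, ← opNorm_col]
    congr 1
    ext i j; rw [Subsingleton.elim j 0]; rfl
  rw [opNorm_unique, ← e, ← ea, ← eb]
  exact h1

end HilbertSchmidt

/-! ### Functionals on the matrix spaces -/

namespace SMOS

variable {X : Type*} [NormedAddCommGroup X] [NormedSpace ℂ X] (S : SMOS X)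

/-- The coordinate functional `x ↦ xₖₗ` on `Mₙ(X)`. -/
def coord {n : ℕ} (k l : Fin n) : S.Mat n →L[ℂ] X :=
  LinearMap.mkContinuousOfExistsBound
    { toFun := fun x : Matrix (Fin n) (Fin n) X => x k l
      map_add' := fun _ _ => rfl
      map_smul' := fun _ _ => rfl } (by
    refine ⟨_, fun x => le_trans (le_of_eq ?_)
      (S.mnorm_lr_le (Matrix.single (0 : Fin 1) k 1) x (Matrix.single l (0 : Fin 1) 1))⟩
    rw [← S.mnorm_one]
    congr 1
    ext i j
    rw [Subsingleton.elim i 0, Subsingleton.elim j 0]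
    simp [lr, Matrix.single, ite_and]
    rfl)

/-- The functional `x ↦ (f, x)` on `Mₙ(X)`; the inverse of `theta`. -/
def ofPairing {n : ℕ} (f : Matrix (Fin n) (Fin n) (StrongDual ℂ X)) : StrongDual ℂ (S.Mat n) :=
  ∑ k, ∑ l, (f k l).comp (S.coord k l)

theorem ofPairing_apply {n : ℕ} (f : Matrix (Fin n) (Fin n) (StrongDual ℂ X)) (x : S.Mat n) :
    S.ofPairing f x = pairing f x := by
  simp only [ofPairing, _root_.sum_apply]; rfl

theorem pairing_theta {n : ℕ} (F : StrongDual ℂ (S.Mat n)) (x : S.Mat n) :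
    pairing (S.theta F) x = F x := by
  have e : x = ∑ k, ∑ l, S.entry k l (x k l) := Matrix.matrix_eq_sum_single x
  conv_rhs => rw [e]
  rw [map_sum]
  simp_rw [map_sum]
  rfl

theorem ofPairing_theta {n : ℕ} (F : StrongDual ℂ (S.Mat n)) : S.ofPairing (S.theta F) = F :=
  ContinuousLinearMap.ext fun x => (S.ofPairing_apply _ x).trans (S.pairing_theta F x)

theorem theta_ofPairing {n : ℕ} (f : Matrix (Fin n) (Fin n) (StrongDual ℂ X)) :
    S.theta (S.ofPairing f) = f := by
  refine Matrix.ext fun k l => ContinuousLinearMap.ext fun x => ?_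
  refine (S.ofPairing_apply f _).trans ?_
  change ∑ i, ∑ j, f i j (Matrix.single k l x i j) = f k l x
  rw [Finset.sum_eq_single k, Finset.sum_eq_single l]
  · simp
  · intro j _ hj; simp [Matrix.single, hj.symm]
  · simp
  · intro i _ hi
    refine Finset.sum_eq_zero fun j _ => ?_
    simp [Matrix.single, hi.symm]
  · simp

end SMOS

/-! ### Direct sums of coordinate spaces -/

section Concatenation

variable {r₁ r₂ : ℕ}

/-- The coordinate projection of `ℂ^(r₁ + r₂)` onto its first `r₁` coordinates. -/
def projLeft (r₁ r₂ : ℕ) : Matrix (Fin r₁) (Fin (r₁ + r₂)) ℂ :=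
  Matrix.of fun i s => if Fin.castAdd r₂ i = s then 1 else 0

/-- The coordinate projection of `ℂ^(r₁ + r₂)` onto its last `r₂` coordinates. -/
def projRight (r₁ r₂ : ℕ) : Matrix (Fin r₂) (Fin (r₁ + r₂)) ℂ :=
  Matrix.of fun i s => if Fin.natAdd r₁ i = s then 1 else 0

theorem projLeft_mul_conjTranspose : projLeft r₁ r₂ * (projLeft r₁ r₂)ᴴ = 1 := by
  ext i j
  simp [projLeft, Matrix.mul_apply, Matrix.one_apply, eq_comm, apply_ite star]

theorem projRight_mul_conjTranspose : projRight r₁ r₂ * (projRight r₁ r₂)ᴴ = 1 := by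
  ext i j
  simp [projRight, Matrix.mul_apply, Matrix.one_apply, eq_comm, apply_ite star]

theorem castAdd_ne_natAdd (i : Fin r₁) (j : Fin r₂) : Fin.castAdd r₂ i ≠ Fin.natAdd r₁ j := by
  intro h
  have := congrArg Fin.val h
  simp only [Fin.val_castAdd, Fin.val_natAdd] at this
  omega

theorem projLeft_mul_projRight : projLeft r₁ r₂ * (projRight r₁ r₂)ᴴ = 0 := by
  ext i j
  simp [projLeft, projRight, Matrix.mul_apply, apply_ite star, castAdd_ne_natAdd i j]

theorem projRight_mul_projLeft : projRight r₁ r₂ * (projLeft r₁ r₂)ᴴ = 0 := by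
  ext i j
  simp [projLeft, projRight, Matrix.mul_apply, apply_ite star, (castAdd_ne_natAdd j i).symm]

theorem proj_sum : (projLeft r₁ r₂)ᴴ * projLeft r₁ r₂ + (projRight r₁ r₂)ᴴ * projRight r₁ r₂ =
    1 := by
  ext s t
  refine Fin.addCases (fun i => ?_) (fun i => ?_) s <;>
  refine Fin.addCases (fun j => ?_) (fun j => ?_) t <;>
  simp [projLeft, projRight, Matrix.mul_apply, apply_ite star, castAdd_ne_natAdd,
    (castAdd_ne_natAdd _ _).symm, Matrix.one_apply, eq_comm]

end Concatenation

/-! ### Densities of positive functionals -/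

section Positive

open scoped ComplexOrder MatrixOrder Matrix.Norms.L2Operator

variable {n : ℕ}

/-- Up to an arbitrarily small multiple of the trace, which makes its density `Cᴴ C` invertible, a
positive functional is `a aᴴ ↦ ‖C a‖²` in the Hilbert–Schmidt norm. Invertibility lets `C` be
divided out of a functional in `exists_factorization`. -/
theorem exists_invertible_density (φ : Matrix (Fin n) (Fin n) ℂ →ₗ[ℝ] ℝ)
    (hφ : ∀ v : Matrix (Fin n) (Fin 1) ℂ, 0 ≤ φ (v * vᴴ)) (ε : ℝ) (hε : 0 < ε) :
    ∃ C : Matrix (Fin n) (Fin n) ℂ, IsUnit C ∧ hs C ^ 2 = φ 1 + ε * n ∧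
      ∀ (r : ℕ) (a : Matrix (Fin n) (Fin r) ℂ), φ (a * aᴴ) ≤ hs (C * a) ^ 2 := by
  -- The density of the complex-linear functional with real part `φ`.
  set P : Matrix (Fin n) (Fin n) ℂ := Matrix.of fun i j =>
    (φ (Matrix.single j i 1) : ℂ) - Complex.I * φ (Matrix.single j i Complex.I) with hP
  have hφP : ∀ A : Matrix (Fin n) (Fin n) ℂ, φ A = (A * P).trace.re := fun A => by
    have hs1 : ∀ (i j : Fin n) (c : ℂ), Matrix.single i j c =
        c.re • Matrix.single i j (1 : ℂ) + c.im • Matrix.single i j Complex.I := fun i j c => by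
      rw [Matrix.smul_single, Matrix.smul_single, ← Matrix.single_add]
      congr 1
      simp
    conv_lhs => rw [Matrix.matrix_eq_sum_single A]
    simp only [map_sum, Matrix.trace, Matrix.diag_apply, Matrix.mul_apply, Complex.re_sum]
    refine Finset.sum_congr rfl fun i _ => Finset.sum_congr rfl fun j _ => ?_
    rw [hs1, map_add, map_smul, map_smul]
    simp [hP]
  -- Only the Hermitian part of the density is seen on the self-adjoint matrices `a * aᴴ`.
  set H : Matrix (Fin n) (Fin n) ℂ := (2⁻¹ : ℂ) • (P + Pᴴ) with hH
  have hHh : H.IsHermitian := by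
    rw [hH, Matrix.IsHermitian, Matrix.conjTranspose_smul, Matrix.conjTranspose_add,
      Matrix.conjTranspose_conjTranspose, add_comm]
    simp
  have hφH : ∀ (r : ℕ) (a : Matrix (Fin n) (Fin r) ℂ), φ (a * aᴴ) = (aᴴ * H * a).trace.re := by
    intro r a
    have e : (aᴴ * Pᴴ * a).trace = star (aᴴ * P * a).trace := by
      rw [← Matrix.trace_conjTranspose]; simp [Matrix.mul_assoc]
    rw [hφP, Matrix.mul_assoc, Matrix.trace_mul_comm, hH, Matrix.mul_smul, Matrix.smul_mul,
      Matrix.trace_smul, Matrix.mul_add, Matrix.add_mul, Matrix.trace_add, e]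
    simp
    ring
  have hpos : (H + (ε : ℂ) • 1).PosDef := by
    refine Matrix.PosDef.posSemidef_add ?_ ?_
    · refine Matrix.PosSemidef.of_dotProduct_mulVec_nonneg hHh fun v => ?_
      have h1 := hφ (Matrix.of fun i _ => v i)
      rw [hφH] at h1
      have h2 : ((Matrix.of fun i (_ : Fin 1) => v i)ᴴ * H * Matrix.of fun i _ => v i).trace =
          star v ⬝ᵥ (H *ᵥ v) := by
        rw [Matrix.mul_assoc]; simp [Matrix.trace]; rfl
      rw [h2] at h1
      exact Complex.nonneg_iff.mpr ⟨h1, (hHh.im_star_dotProduct_mulVec_self v).symm⟩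
    · exact Matrix.PosDef.one.smul (by exact_mod_cast hε)
  obtain ⟨C, hC⟩ := CStarAlgebra.nonneg_iff_eq_star_mul_self.mp hpos.posSemidef.nonneg
  rw [Matrix.star_eq_conjTranspose] at hC
  have key : ∀ (r : ℕ) (a : Matrix (Fin n) (Fin r) ℂ),
      hs (C * a) ^ 2 = φ (a * aᴴ) + ε * hs a ^ 2 := fun r a => by
    rw [hs_sq, hφH, hs_sq, Matrix.conjTranspose_mul]
    have : aᴴ * Cᴴ * (C * a) = aᴴ * H * a + (ε : ℂ) • (aᴴ * a) := by
      rw [Matrix.mul_assoc, ← Matrix.mul_assoc Cᴴ, ← hC, Matrix.add_mul, Matrix.mul_add,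
        Matrix.mul_assoc]
      simp
    rw [this, Matrix.trace_add, Matrix.trace_smul]
    simp
  refine ⟨C, ?_, ?_, fun r a => ?_⟩
  · have := hpos.isUnit
    rw [hC] at this
    exact isUnit_of_mul_isUnit_right this
  · have := key n 1
    rw [Matrix.mul_one, Matrix.conjTranspose_one, Matrix.mul_one, hs_sq 1] at this
    simpa using this
  · rw [key]
    have := mul_nonneg hε.le (sq_nonneg (hs a))
    linarith

end Positive

/-! ### Domination by positive functionals -/

namespace SMOS

open scoped Matrix.Norms.L2Operator

variable {X : Type*} [NormedAddCommGroup X] [NormedSpace ℂ X] (S : SMOS X)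

/-- The triples `(a a⋆, b⋆ b, t)` with `t ≤ Re F(a x b)` for some `x` in the unit ball of some
`M_r(X)`. Letting the size `r` vary makes the set closed under addition. -/
def factorCone {n : ℕ} (F : StrongDual ℂ (S.Mat n)) :
    Set (Matrix (Fin n) (Fin n) ℂ × Matrix (Fin n) (Fin n) ℂ × ℝ) :=
  {p | ∃ (r : ℕ) (a : Matrix (Fin n) (Fin r) ℂ) (x : Matrix (Fin r) (Fin r) X)
    (b : Matrix (Fin r) (Fin n) ℂ), S.mnorm r x ≤ 1 ∧ p.1 = a * aᴴ ∧ p.2.1 = bᴴ * b ∧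
      p.2.2 ≤ (F (lr a x b : Matrix (Fin n) (Fin n) X)).re}

/-! The three lemmas below are linearity of `F` for arguments typed as plain matrices, where the
instances of `S.Mat n` are not found syntactically. -/

theorem map_smul_mat {n : ℕ} (F : StrongDual ℂ (S.Mat n)) (c : ℂ) (x : Matrix (Fin n) (Fin n) X) :
    F (c • x : Matrix (Fin n) (Fin n) X) = c * F x := map_smul F c x

theorem map_add_mat {n : ℕ} (F : StrongDual ℂ (S.Mat n)) (x y : Matrix (Fin n) (Fin n) X) :
    F (x + y : Matrix (Fin n) (Fin n) X) = F x + F y := map_add F x y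

theorem map_zero_mat {n : ℕ} (F : StrongDual ℂ (S.Mat n)) :
    F (0 : Matrix (Fin n) (Fin n) X) = 0 := map_zero F

theorem smul_mem_factorCone {n : ℕ} (F : StrongDual ℂ (S.Mat n)) {s : ℝ} (hs : 0 ≤ s)
    {p : Matrix (Fin n) (Fin n) ℂ × Matrix (Fin n) (Fin n) ℂ × ℝ} (hp : p ∈ S.factorCone F) :
    s • p ∈ S.factorCone F := by
  obtain ⟨r, a, x, b, hx, h1, h2, h3⟩ := hp
  have hss : ((Real.sqrt s : ℝ) : ℂ) * (Real.sqrt s : ℝ) = (s : ℝ) := by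
    rw [← Complex.ofReal_mul, Real.mul_self_sqrt hs]
  have hre : ∀ A : Matrix (Fin n) (Fin n) ℂ, (s : ℂ) • A = s • A := fun A => by
    ext i j; simp
  refine ⟨r, ((Real.sqrt s : ℝ) : ℂ) • a, x, ((Real.sqrt s : ℝ) : ℂ) • b, hx, ?_, ?_, ?_⟩
  · change s • p.1 = _
    rw [← hre, h1, Matrix.conjTranspose_smul, Matrix.smul_mul, Matrix.mul_smul, smul_smul,
      RCLike.star_def, Complex.conj_ofReal, hss]
  · change s • p.2.1 = _
    rw [← hre, h2, Matrix.conjTranspose_smul, Matrix.smul_mul, Matrix.mul_smul, smul_smul,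
      RCLike.star_def, Complex.conj_ofReal, hss]
  · rw [lr_smul_smul, hss, map_smul_mat, Complex.re_ofReal_mul]
    exact mul_le_mul_of_nonneg_left h3 hs

/-- The sum `a₁ x₁ b₁ + a₂ x₂ b₂` is a single product: the row `(a₁, a₂)` times `x₁ ⊕ x₂` times the
column with entries `b₁`, `b₂`. The operator space axiom gives `‖x₁ ⊕ x₂‖ ≤ 1`. -/
theorem add_mem_factorCone {n : ℕ} (F : StrongDual ℂ (S.Mat n))
    {p q : Matrix (Fin n) (Fin n) ℂ × Matrix (Fin n) (Fin n) ℂ × ℝ} (hp : p ∈ S.factorCone F)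
    (hq : q ∈ S.factorCone F) : p + q ∈ S.factorCone F := by
  obtain ⟨r₁, a₁, x₁, b₁, hx₁, h1, h2, h3⟩ := hp
  obtain ⟨r₂, a₂, x₂, b₂, hx₂, k1, k2, k3⟩ := hq
  set u := projLeft r₁ r₂ with hu
  set v := projRight r₁ r₂ with hv
  have uu : u * uᴴ = 1 := projLeft_mul_conjTranspose
  have vv : v * vᴴ = 1 := projRight_mul_conjTranspose
  have uv : u * vᴴ = 0 := projLeft_mul_projRight
  have vu : v * uᴴ = 0 := projRight_mul_projLeft
  have huv : uᴴ * u + vᴴ * v = 1 := proj_sum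
  have e1 : (a₁ * u + a₂ * v) * uᴴ = a₁ := by
    rw [Matrix.add_mul, Matrix.mul_assoc, Matrix.mul_assoc, uu, vu]; simp
  have e2 : (a₁ * u + a₂ * v) * vᴴ = a₂ := by
    rw [Matrix.add_mul, Matrix.mul_assoc, Matrix.mul_assoc, uv, vv]; simp
  have e3 : u * (uᴴ * b₁ + vᴴ * b₂) = b₁ := by
    rw [Matrix.mul_add, ← Matrix.mul_assoc, ← Matrix.mul_assoc, uu, uv]; simp
  have e4 : v * (uᴴ * b₁ + vᴴ * b₂) = b₂ := by
    rw [Matrix.mul_add, ← Matrix.mul_assoc, ← Matrix.mul_assoc, vv, vu]; simp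
  refine ⟨r₁ + r₂, a₁ * u + a₂ * v, lr uᴴ x₁ u + lr vᴴ x₂ v, uᴴ * b₁ + vᴴ * b₂, ?_, ?_, ?_, ?_⟩
  · refine (S.mnorm_ruan _ _ _ _ _ _ _ _ _).trans ?_
    rw [Matrix.conjTranspose_conjTranspose, Matrix.conjTranspose_conjTranspose, huv]
    have h1 : ‖(1 : Matrix (Fin (r₁ + r₂)) (Fin (r₁ + r₂)) ℂ)‖ ≤ 1 := by
      rw [← Matrix.diagonal_one, Matrix.l2_opNorm_diagonal]
      exact (pi_norm_le_iff_of_nonneg zero_le_one).mpr fun _ => by simp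
    rw [Real.mul_self_sqrt (norm_nonneg _)]
    exact mul_le_one₀ h1 (le_max_of_le_left (apply_nonneg _ _)) (max_le hx₁ hx₂)
  · rw [Matrix.conjTranspose_add, Matrix.conjTranspose_mul, Matrix.conjTranspose_mul,
      Matrix.mul_add, ← Matrix.mul_assoc, ← Matrix.mul_assoc, e1, e2, Prod.fst_add, h1, k1]
  · rw [Matrix.conjTranspose_add, Matrix.conjTranspose_mul, Matrix.conjTranspose_mul,
      Matrix.conjTranspose_conjTranspose, Matrix.conjTranspose_conjTranspose,
      Matrix.add_mul, Matrix.mul_assoc, Matrix.mul_assoc, e3, e4, Prod.snd_add, Prod.fst_add,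
      h2, k2]
  · rw [lr_add, lr_lr, lr_lr, e1, e2, e3, e4, map_add_mat, Complex.add_re]
    exact add_le_add h3 k3

/-- A functional of norm at most one is dominated on all products `a x b` by two positive
functionals on the scalar matrices, of total mass at most about one half each. They come from
separating `factorCone F` from the open cone `(‖A‖ + ‖B‖) / 2 < t`; the two are disjoint because
`‖a‖ ‖b‖ ≤ (‖a aᴴ‖ + ‖bᴴ b‖) / 2`. -/
theorem exists_dominating_functionals {n : ℕ} (F : StrongDual ℂ (S.Mat n)) (hF : ‖F‖ ≤ 1)
    (ε : ℝ) (hε : 0 < ε) :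
    ∃ φ ψ : Matrix (Fin n) (Fin n) ℂ →ₗ[ℝ] ℝ, φ 1 ≤ 1 / 2 + ε ∧ ψ 1 ≤ 1 / 2 + ε ∧
      (∀ (r : ℕ) (a : Matrix (Fin n) (Fin r) ℂ), 0 ≤ φ (a * aᴴ)) ∧
      (∀ (r : ℕ) (b : Matrix (Fin r) (Fin n) ℂ), 0 ≤ ψ (bᴴ * b)) ∧
      ∀ (r : ℕ) (a : Matrix (Fin n) (Fin r) ℂ) (x : Matrix (Fin r) (Fin r) X)
        (b : Matrix (Fin r) (Fin n) ℂ), S.mnorm r x ≤ 1 →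
        (F (lr a x b : Matrix (Fin n) (Fin n) X)).re ≤ φ (a * aᴴ) + ψ (bᴴ * b) := by
  let M := Matrix (Fin n) (Fin n) ℂ
  let U : Set (M × M × ℝ) := {p | (‖p.1‖ + ‖p.2.1‖) / 2 < p.2.2}
  have hUo : IsOpen U := isOpen_lt (by fun_prop) (by fun_prop)
  have hnorm : ∀ (s : ℝ) (A : M), 0 ≤ s → ‖s • A‖ = s * ‖A‖ := fun s A hs => by
    have : s • A = (s : ℂ) • A := by ext i j; simp
    rw [this, norm_smul, Complex.norm_real, Real.norm_of_nonneg hs]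
  have hUc : Convex ℝ U := by
    intro p hp q hq s t hs ht hst
    change (‖s • p.1 + t • q.1‖ + ‖s • p.2.1 + t • q.2.1‖) / 2 < s * p.2.2 + t * q.2.2
    have hp' : (‖p.1‖ + ‖p.2.1‖) / 2 < p.2.2 := hp
    have hq' : (‖q.1‖ + ‖q.2.1‖) / 2 < q.2.2 := hq
    have h1 := norm_add_le (s • p.1) (t • q.1)
    have h2 := norm_add_le (s • p.2.1) (t • q.2.1)
    rw [hnorm _ _ hs, hnorm _ _ ht] at h1 h2
    have h3 : s * ((‖p.1‖ + ‖p.2.1‖) / 2) + t * ((‖q.1‖ + ‖q.2.1‖) / 2) <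
        s * p.2.2 + t * q.2.2 := by
      rcases hs.eq_or_lt with rfl | hs'
      · have : t = 1 := by linarith
        subst this; linarith
      · exact add_lt_add_of_lt_of_le (mul_lt_mul_of_pos_left hp' hs')
          (mul_le_mul_of_nonneg_left hq'.le ht)
    linarith
  have hKc : Convex ℝ (S.factorCone F) := fun p hp q hq s t hs ht _ =>
    S.add_mem_factorCone F (S.smul_mem_factorCone F hs hp) (S.smul_mem_factorCone F ht hq)
  have hdisj : Disjoint U (S.factorCone F) := by
    rw [Set.disjoint_left]
    rintro p hp ⟨r, a, x, b, hx, h1, h2, h3⟩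
    have hp' : (‖p.1‖ + ‖p.2.1‖) / 2 < p.2.2 := hp
    have h4 : (F (lr a x b : Matrix (Fin n) (Fin n) X)).re ≤ ‖a‖ * ‖b‖ := by
      refine (Complex.re_le_norm _).trans ((F.le_of_opNorm_le hF _).trans ?_)
      rw [one_mul]
      exact (S.mnorm_lr_le a x b).trans (mul_le_of_le_one_right (by positivity) hx)
    have h5 : ‖a * aᴴ‖ = ‖a‖ * ‖a‖ := by
      have := Matrix.l2_opNorm_conjTranspose_mul_self aᴴ
      rwa [Matrix.conjTranspose_conjTranspose, Matrix.l2_opNorm_conjTranspose] at this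
    rw [h1, h2, h5, Matrix.l2_opNorm_conjTranspose_mul_self] at hp'
    nlinarith [sq_nonneg (‖a‖ - ‖b‖)]
  obtain ⟨f, u, hfU, hfK⟩ := geometric_hahn_banach_open hUc hUo hKc hdisj
  have hu : u ≤ 0 := by
    have := hfK 0 ⟨0, 0, 0, 0, by simp, by simp, by simp, by
      rw [lr_zero_left, map_zero_mat]; simp⟩
    simpa using this
  -- A linear functional bounded below on a cone is nonnegative there.
  have hK : ∀ p ∈ S.factorCone F, 0 ≤ f p := fun p hp => by
    by_contra hneg
    push Not at hneg
    have h1 := hfK _ (S.smul_mem_factorCone F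
      (div_nonneg_of_nonpos (by linarith : u - 1 ≤ 0) hneg.le) hp)
    rw [map_smul, smul_eq_mul, div_mul_cancel₀ _ hneg.ne] at h1
    linarith
  have hU : ∀ p ∈ U, f p < 0 := fun p hp => (hfU p hp).trans_le hu
  have hsplit : ∀ (A B : M) (t : ℝ), f (A, B, t) = f (A, 0, 0) + f (0, B, 0) + t * f (0, 0, 1) := by
    intro A B t
    rw [← smul_eq_mul, ← map_smul, ← map_add, ← map_add]
    simp
  have hc : f (0, 0, 1) < 0 := hU _ (by simp [U])
  -- Dividing by `c` normalises the coefficient of `t` to `-1`.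
  set c := -f (0, 0, 1) with hcdef
  have hc0 : 0 < c := by linarith
  have hnorm1 : ‖(1 : M)‖ ≤ 1 := by
    rw [← Matrix.diagonal_one, Matrix.l2_opNorm_diagonal]
    exact (pi_norm_le_iff_of_nonneg zero_le_one).mpr fun _ => by simp
  refine ⟨c⁻¹ • f.toLinearMap ∘ₗ LinearMap.inl ℝ M (M × ℝ),
    c⁻¹ • f.toLinearMap ∘ₗ LinearMap.inr ℝ M (M × ℝ) ∘ₗ LinearMap.inl ℝ M ℝ,
    ?_, ?_, fun r a => ?_, fun r b => ?_, fun r a x b hx => ?_⟩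
  · have h1 := hU (1, 0, 1 / 2 + ε) (by simp only [U, Set.mem_ofPred_eq, norm_zero]; linarith)
    rw [hsplit] at h1
    change c⁻¹ * f (1, 0, 0) ≤ _
    rw [inv_mul_le_iff₀ hc0]
    have h0 : f ((0 : M), (0 : M), (0 : ℝ)) = 0 := map_zero f
    rw [h0] at h1
    nlinarith
  · have h1 := hU (0, 1, 1 / 2 + ε) (by simp only [U, Set.mem_ofPred_eq, norm_zero]; linarith)
    rw [hsplit] at h1
    change c⁻¹ * f (0, 1, 0) ≤ _
    rw [inv_mul_le_iff₀ hc0]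
    have h0 : f ((0 : M), (0 : M), (0 : ℝ)) = 0 := map_zero f
    rw [h0] at h1
    nlinarith
  · refine mul_nonneg (inv_nonneg.mpr hc0.le) (hK (a * aᴴ, 0, 0) ⟨r, a, 0, 0, ?_, rfl, ?_, ?_⟩)
    · simp
    · simp
    · rw [lr_zero_right, map_zero_mat]; simp
  · refine mul_nonneg (inv_nonneg.mpr hc0.le) (hK (0, bᴴ * b, 0) ⟨r, 0, 0, b, ?_, ?_, rfl, ?_⟩)
    · simp
    · simp
    · rw [lr_zero_left, map_zero_mat]; simp
  · have h1 := hK (a * aᴴ, bᴴ * b, _) ⟨r, a, x, b, hx, rfl, rfl, le_rfl⟩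
    rw [hsplit] at h1
    change _ ≤ c⁻¹ * f (a * aᴴ, 0, 0) + c⁻¹ * f (0, bᴴ * b, 0)
    rw [← mul_add, le_inv_mul_iff₀ hc0]
    nlinarith

/-! ### Factorization of functionals -/

section Norm

open scoped Matrix.Norms.L2Operator

/-- Every functional `F` of norm at most one on `Mₙ(X)` factors as `Θ_F = a f b` with scalar
matrices `a`, `b` and `f ∈ Mₙ(X*)` such that the product of `‖f‖_cb ≤ 2` with the Hilbert–Schmidt
norms of `a` and `b` is as close to one as desired. -/
theorem exists_factorization {n : ℕ} (F : StrongDual ℂ (S.Mat n)) (hF : ‖F‖ ≤ 1) (ε : ℝ)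
    (hε : 0 < ε) :
    ∃ (a b : Matrix (Fin n) (Fin n) ℂ) (f : Matrix (Fin n) (Fin n) (StrongDual ℂ X)),
      S.theta F = lr a f b ∧ S.cbNorm f ≤ 2 ∧ hs a ^ 2 ≤ 1 / 2 + ε ∧ hs b ^ 2 ≤ 1 / 2 + ε := by
  -- `δ` is spent once on the mass of `φ`, `ψ` and once on the trace perturbation, of mass `δ * n`.
  set δ : ℝ := ε / (n + 1) with hδ
  have hn : (0 : ℝ) < n + 1 := by positivity
  have hδ0 : 0 < δ := div_pos hε hn
  have hδε : δ + δ * n = ε := by rw [hδ]; field_simp; ring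
  obtain ⟨φ, ψ, hφ1, hψ1, hφ, hψ, hdom⟩ := S.exists_dominating_functionals F hF δ hδ0
  obtain ⟨C, hCu, hC1, hC⟩ := exists_invertible_density φ (fun v => hφ 1 v) δ hδ0
  obtain ⟨D, hDu, hD1, hD⟩ := exists_invertible_density ψ
    (fun v => by simpa using hψ 1 vᴴ) δ hδ0
  have hDh : IsUnit Dᴴ := by simpa [Matrix.star_eq_conjTranspose] using hDu.star
  have hdom' : ∀ (r : ℕ) (a : Matrix (Fin n) (Fin r) ℂ) (x : Matrix (Fin r) (Fin r) X)
      (b : Matrix (Fin r) (Fin n) ℂ), S.mnorm r x ≤ 1 →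
      (F (lr (C⁻¹ * a) x (b * Dᴴ⁻¹) : Matrix (Fin n) (Fin n) X)).re ≤ hs a ^ 2 + hs b ^ 2 := by
    intro r a x b hx
    refine (hdom r _ x _ hx).trans (add_le_add ((hC r _).trans_eq ?_) ?_)
    · rw [← Matrix.mul_assoc, Matrix.mul_nonsing_inv C ((Matrix.isUnit_iff_isUnit_det C).mp hCu),
        Matrix.one_mul]
    · have h1 := hD r (b * Dᴴ⁻¹)ᴴ
      rw [Matrix.conjTranspose_conjTranspose] at h1
      refine h1.trans_eq ?_
      rw [← hs_conjTranspose (D * _), Matrix.conjTranspose_mul, Matrix.conjTranspose_conjTranspose,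
        Matrix.mul_assoc,
        Matrix.nonsing_inv_mul Dᴴ ((Matrix.isUnit_iff_isUnit_det _).mp hDh), Matrix.mul_one]
  have hCt : Cᵀ * C⁻¹ᵀ = 1 := by
    rw [← Matrix.transpose_mul, Matrix.nonsing_inv_mul C ((Matrix.isUnit_iff_isUnit_det C).mp hCu),
      Matrix.transpose_one]
  have hDt : Dᴴ⁻¹ᵀ * Dᴴᵀ = 1 := by
    rw [← Matrix.transpose_mul,
      Matrix.mul_nonsing_inv Dᴴ ((Matrix.isUnit_iff_isUnit_det _).mp hDh), Matrix.transpose_one]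
  refine ⟨Cᵀ, Dᴴᵀ, lr C⁻¹ᵀ (S.theta F) Dᴴ⁻¹ᵀ, ?_, ?_, ?_, ?_⟩
  · rw [lr_lr, hCt, hDt, lr_one_one]
  · have hball : ∀ (m : ℕ) (x : Matrix (Fin m) (Fin m) X), S.mnorm m x ≤ 1 →
        ‖amp (lr C⁻¹ᵀ (S.theta F) Dᴴ⁻¹ᵀ) x‖ ≤ 2 := by
      intro m x hx
      refine opNorm_le_of_dotProduct _ _ zero_le_two fun a b => ?_
      rw [← pairing_lr_right, pairing_lr_left, Matrix.transpose_transpose,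
        Matrix.transpose_transpose, lr_lr]
      rw [show pairing (S.theta F) (lr (C⁻¹ * a) x (b * Dᴴ⁻¹)) =
        F (lr (C⁻¹ * a) x (b * Dᴴ⁻¹) : Matrix (Fin n) (Fin n) X) from S.pairing_theta F _]
      by_cases ha : hs a = 0
      · rw [eq_zero_of_hs_eq_zero ha, Matrix.mul_zero, lr_zero_left, map_zero_mat, norm_zero]
        exact mul_nonneg (mul_nonneg zero_le_two (hs_nonneg _)) (hs_nonneg _)
      by_cases hb : hs b = 0
      · rw [eq_zero_of_hs_eq_zero hb, Matrix.zero_mul, lr_zero_right, map_zero_mat, norm_zero]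
        exact mul_nonneg (mul_nonneg zero_le_two (hs_nonneg _)) (hs_nonneg _)
      have ha0 : 0 < hs a := lt_of_le_of_ne (hs_nonneg a) (Ne.symm ha)
      have hb0 : 0 < hs b := lt_of_le_of_ne (hs_nonneg b) (Ne.symm hb)
      set w := F (lr (C⁻¹ * a) x (b * Dᴴ⁻¹) : Matrix (Fin n) (Fin n) X) with hw
      -- Normalising `a` and `b` and rotating the phase turns the sum of squares into a product.
      obtain ⟨u, hu, huw⟩ : ∃ u : ℂ, ‖u‖ = 1 ∧ u * w = ‖w‖ := by
        obtain ⟨u, hu, huw⟩ := RCLike.exists_norm_eq_mul_self w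
        exact ⟨u, hu, huw.symm⟩
      have h1 := hdom' m ((u * (hs a : ℂ)⁻¹) • a) x (((hs b : ℂ)⁻¹) • b) hx
      rw [Matrix.mul_smul, Matrix.smul_mul, lr_smul_smul, map_smul_mat, ← hw, hs_smul, hs_smul,
        norm_mul, hu, one_mul, norm_inv, norm_inv, Complex.norm_real, Complex.norm_real,
        Real.norm_of_nonneg ha0.le, Real.norm_of_nonneg hb0.le, inv_mul_cancel₀ ha,
        inv_mul_cancel₀ hb] at h1
      have h2 : u * (hs a : ℂ)⁻¹ * (hs b : ℂ)⁻¹ * w = (((hs a)⁻¹ * (hs b)⁻¹ * ‖w‖ : ℝ) : ℂ) := by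
        push_cast
        rw [← huw]; ring
      rw [h2, Complex.ofReal_re, ← mul_inv, inv_mul_le_iff₀ (mul_pos ha0 hb0)] at h1
      linarith
    exact Real.sSup_le (by rintro r ⟨m, x, hx, rfl⟩; exact hball m x hx) zero_le_two
  · rw [hs_transpose, hC1]; linarith
  · rw [hs_transpose, hs_conjTranspose, hD1]; linarith

theorem norm_ofPairing_lr_le {m n : ℕ} (a : Matrix (Fin n) (Fin m) ℂ)
    (f : Matrix (Fin m) (Fin m) (StrongDual ℂ X)) (b : Matrix (Fin m) (Fin n) ℂ) :
    ‖S.ofPairing (lr a f b)‖ ≤ S.cbNorm f * hs a * hs b := by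
  refine ContinuousLinearMap.opNorm_le_bound _
    (mul_nonneg (mul_nonneg (S.cbNorm_nonneg f) (hs_nonneg a)) (hs_nonneg b)) fun x => ?_
  rw [ofPairing_apply]
  change ‖pairing (lr a f b) (x : Matrix (Fin n) (Fin n) X)‖ ≤ _
  rw [pairing_lr_left a f b x, pairing_lr_right f aᵀ x bᵀ]
  refine (norm_dotProduct_mulVec_le _ _ _).trans ?_
  rw [hs_transpose, hs_transpose]
  calc _ ≤ S.cbNorm f * S.mnorm n x * hs a * hs b := by
        gcongr
        · exact hs_nonneg b
        · exact hs_nonneg a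
        · exact S.norm_amp_le f x
    _ = S.cbNorm f * hs a * hs b * ‖x‖ := by
        change _ = _ * S.mnorm n x
        ring

end Norm

/-! ### The map into the bidual, and its norm -/

/-- The map `Λ : Mₙ(X**) → Mₙ(X)**`, `Λ(z)(F) = (z, Θ_F)`. -/
def bidualMap (n : ℕ) : S.dual.dual.Mat n →ₗ[ℂ] StrongDual ℂ (StrongDual ℂ (S.Mat n)) where
  toFun z := ∑ k, ∑ l, ContinuousLinearMap.comp
    ((z : Matrix (Fin n) (Fin n) (StrongDual ℂ (StrongDual ℂ X))) k l)
    (ContinuousLinearMap.precomp ℂ (S.entry k l))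
  map_add' z w := by
    simp only [← Finset.sum_add_distrib]
    refine Finset.sum_congr rfl fun k _ => Finset.sum_congr rfl fun l _ => ?_
    ext F; rfl
  map_smul' c z := by
    simp only [Finset.smul_sum]
    refine Finset.sum_congr rfl fun k _ => Finset.sum_congr rfl fun l _ => ?_
    ext F; rfl

theorem bidualMap_apply {n : ℕ} (z : S.dual.dual.Mat n) (F : StrongDual ℂ (S.Mat n)) :
    S.bidualMap n z F = pairing z (S.theta F) := by
  change (∑ k, ∑ l, ContinuousLinearMap.comp
    ((z : Matrix (Fin n) (Fin n) (StrongDual ℂ (StrongDual ℂ X))) k l)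
    (ContinuousLinearMap.precomp ℂ (S.entry k l))) F = _
  simp only [_root_.sum_apply]; rfl

theorem bidualMap_ofPairing {n : ℕ} (z : S.dual.dual.Mat n)
    (f : Matrix (Fin n) (Fin n) (StrongDual ℂ X)) :
    S.bidualMap n z (S.ofPairing f) = pairing z f := by
  rw [bidualMap_apply, theta_ofPairing]

theorem bidualMap_surjective (n : ℕ) : Function.Surjective (S.bidualMap n) := by
  intro G
  refine ⟨(Matrix.of fun k l => G.comp (ContinuousLinearMap.precomp ℂ (S.coord k l)) :
    Matrix (Fin n) (Fin n) (StrongDual ℂ (StrongDual ℂ X))), ContinuousLinearMap.ext fun F => ?_⟩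
  refine (S.bidualMap_apply _ F).trans ?_
  conv_rhs => rw [← S.ofPairing_theta F, ofPairing, map_sum]
  simp_rw [map_sum]
  rfl

section Isometry

open scoped Matrix.Norms.L2Operator

/-- If `Θ_F = a f b`, then `(z, Θ_F)` is a coefficient of the amplification of `z` at `f`. -/
theorem norm_bidualMap_le {n : ℕ} (z : S.dual.dual.Mat n) : ‖S.bidualMap n z‖ ≤ ‖z‖ := by
  refine ContinuousLinearMap.opNorm_le_of_unit_norm (norm_nonneg z) fun F hF => ?_
  rw [bidualMap_apply]
  refine le_of_forall_pos_le_add fun ε hε => ?_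
  have hz : (0 : ℝ) ≤ ‖z‖ := norm_nonneg z
  obtain ⟨a, b, f, hf, hf2, ha, hb⟩ := S.exists_factorization F hF.le (ε / (2 * (‖z‖ + 1)))
    (by positivity)
  rw [hf]
  change ‖pairing (z : Matrix (Fin n) (Fin n) (StrongDual ℂ (StrongDual ℂ X))) (lr a f b)‖ ≤ _
  rw [pairing_lr_right z a f b]
  refine (norm_dotProduct_mulVec_le _ _ _).trans ?_
  have h1 : ‖amp z f‖ ≤ ‖z‖ * 2 :=
    (S.dual.norm_amp_le z f).trans (mul_le_mul_of_nonneg_left hf2 hz)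
  have h2 : hs a * hs b ≤ 1 / 2 + ε / (2 * (‖z‖ + 1)) := by
    nlinarith [sq_nonneg (hs a - hs b)]
  calc ‖amp z f‖ * hs a * hs b = ‖amp z f‖ * (hs a * hs b) := mul_assoc _ _ _
    _ ≤ (‖z‖ * 2) * (1 / 2 + ε / (2 * (‖z‖ + 1))) := by
        gcongr
        exact mul_nonneg (hs_nonneg a) (hs_nonneg b)
    _ = ‖z‖ + ε * (‖z‖ / (‖z‖ + 1)) := by field_simp
    _ ≤ ‖z‖ + ε := by
        have : ‖z‖ / (‖z‖ + 1) ≤ 1 := (div_le_one (by positivity)).mpr (by linarith)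
        nlinarith

/-- The coefficients of the amplification of `z` at `f` are values of `Λ(z)` at functionals of norm
at most `‖f‖_cb`. -/
theorem norm_le_norm_bidualMap {n : ℕ} (z : S.dual.dual.Mat n) : ‖z‖ ≤ ‖S.bidualMap n z‖ := by
  have h0 : 0 ≤ ‖S.bidualMap n z‖ := norm_nonneg (S.bidualMap n z)
  refine S.dual.cbNorm_le z _ h0 fun m f => ?_
  have hf : 0 ≤ S.dual.mnorm m f := apply_nonneg _ _
  refine opNorm_le_of_dotProduct _ _ (mul_nonneg h0 hf) fun a b => ?_
  rw [← pairing_lr_right z a f b, show pairing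
    (z : Matrix (Fin n) (Fin n) (StrongDual ℂ (StrongDual ℂ X))) (lr a f b) =
    S.bidualMap n z (S.ofPairing (lr a f b)) from (S.bidualMap_ofPairing z _).symm]
  refine ((S.bidualMap n z).le_opNorm _).trans ?_
  refine (mul_le_mul_of_nonneg_left (S.norm_ofPairing_lr_le a f b) h0).trans_eq ?_
  change _ = _ * S.cbNorm f * _ * _
  ring

end Isometry

/-- The isometric isomorphism `Mₙ(X**) ≅ Mₙ(X)**`. -/
def bidualEquiv (n : ℕ) : S.dual.dual.Mat n ≃ₗᵢ[ℂ] StrongDual ℂ (StrongDual ℂ (S.Mat n)) :=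
  LinearIsometryEquiv.ofSurjective
    ⟨S.bidualMap n, fun z => le_antisymm (S.norm_bidualMap_le z) (S.norm_le_norm_bidualMap z)⟩
    (S.bidualMap_surjective n)

theorem bidualEquiv_apply {n : ℕ} (z : S.dual.dual.Mat n) (F : StrongDual ℂ (S.Mat n)) :
    S.bidualEquiv n z F = pairing z (S.theta F) := S.bidualMap_apply z F

theorem bidualEquiv_ofPairing {n : ℕ} (z : S.dual.dual.Mat n)
    (f : Matrix (Fin n) (Fin n) (StrongDual ℂ X)) :
    S.bidualEquiv n z (S.ofPairing f) = pairing z f := S.bidualMap_ofPairing z f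

/-! ### Involution and order -/

section Order

open scoped ComplexOrder

theorem starMat_apply {n : ℕ} (x : S.Mat n) : S.starMat n x = matStar S.adj x := rfl

theorem matStar_single {n : ℕ} (k l : Fin n) (x : X) :
    matStar S.adj (Matrix.single k l x) = Matrix.single l k (S.adj x) := by
  ext i j
  simp only [matStar, Matrix.of_apply, Matrix.single]
  by_cases h : k = j ∧ l = i
  · simp [h]
  · rw [if_neg h, if_neg (fun h' => h h'.symm), map_zero]

theorem theta_dualStar {n : ℕ} (F : StrongDual ℂ (S.Mat n)) :
    S.theta (dualStar (S.starMat n) F) = matStar (dualStar S.adj) (S.theta F) := by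
  refine Matrix.ext fun k l => ContinuousLinearMap.ext fun x => ?_
  change star (F (matStar S.adj (Matrix.single k l x) : Matrix (Fin n) (Fin n) X)) = _
  rw [matStar_single]
  rfl

theorem pairing_matStar {n : ℕ} (f : Matrix (Fin n) (Fin n) (StrongDual ℂ X))
    (x : Matrix (Fin n) (Fin n) X) :
    pairing (matStar (dualStar S.adj) f) x = star (pairing f (matStar S.adj x)) := by
  simp only [pairing, matStar, Matrix.of_apply, dualStar_apply, star_sum]
  exact Finset.sum_comm

theorem bidualEquiv_starMat {n : ℕ} (z : S.dual.dual.Mat n) :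
    S.bidualEquiv n (S.dual.dual.starMat n z) =
      dualStar (dualStar (S.starMat n)) (S.bidualEquiv n z) := by
  refine ContinuousLinearMap.ext fun F => ?_
  rw [dualStar_apply, bidualEquiv_apply, bidualEquiv_apply, theta_dualStar, starMat_apply]
  exact S.dual.pairing_matStar z (S.theta F)

/-- The amplification of a self-adjoint matrix of functionals at a self-adjoint point is
positive semidefinite as soon as its quadratic form, in terms of the pairing, is nonnegative. -/
theorem amp_posSemidef {m n : ℕ} {f : Matrix (Fin n) (Fin n) (StrongDual ℂ X)}
    {x : Matrix (Fin m) (Fin m) X} (hf : matStar (dualStar S.adj) f = f)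
    (hx : matStar S.adj x = x)
    (h : ∀ b : Matrix (Fin m) (Fin n) ℂ, 0 ≤ (pairing f (lr bᴴ x b)).re) :
    (amp f x).PosSemidef := by
  have hH : (amp f x).IsHermitian := by
    have := S.amp_matStar f x
    rw [hf, hx] at this
    exact this.symm
  refine Matrix.PosSemidef.of_dotProduct_mulVec_nonneg hH fun v => ?_
  have h1 := h (Matrix.of fun i k => v (i, k))
  rw [pairing_lr_right] at h1
  exact Complex.nonneg_iff.mpr ⟨h1, (hH.im_star_dotProduct_mulVec_self v).symm⟩

theorem pairing_nonneg_of_posSemidef {m n : ℕ} {f : Matrix (Fin n) (Fin n) (StrongDual ℂ X)}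
    {x : Matrix (Fin m) (Fin m) X} (h : (amp f x).PosSemidef) (b : Matrix (Fin m) (Fin n) ℂ) :
    0 ≤ (pairing f (lr bᴴ x b)).re := by
  rw [pairing_lr_right]
  exact (Complex.nonneg_iff.mp (h.dotProduct_mulVec_nonneg (colVec b))).1

theorem lr_mem_cone {m n : ℕ} (b : Matrix (Fin m) (Fin n) ℂ) {x : Matrix (Fin m) (Fin m) X}
    (hx : x ∈ S.cone m) : lr bᴴ x b ∈ S.cone n := by
  have := S.cone_compress n m m b 0 x hx x hx
  rwa [lr_zero_right, add_zero] at this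

/-- If `F` is positive, then `Θ_F : X → Mₙ` is completely positive: its quadratic forms at
`x ∈ M_m(X)₊` are values of `F` at compressions `bᴴ x b ∈ Mₙ(X)₊`. -/
theorem theta_mem_cone {n : ℕ} {F : StrongDual ℂ (S.Mat n)}
    (hF : F ∈ dualCone (S.starMat n) (S.cone n)) : S.theta F ∈ S.dual.cone n := by
  have hs : matStar (dualStar S.adj) (S.theta F) = S.theta F := by
    rw [← theta_dualStar, hF.1]
  refine ⟨hs, fun m x hx => S.amp_posSemidef hs (S.cone_star m x hx) fun b => ?_⟩
  exact (hF.2 _ (S.lr_mem_cone b hx)).trans_eq (congrArg _ (S.pairing_theta F _).symm)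

theorem ofPairing_mem_dualCone {n : ℕ} {f : Matrix (Fin n) (Fin n) (StrongDual ℂ X)}
    (hf : f ∈ S.dual.cone n) : S.ofPairing f ∈ dualCone (S.starMat n) (S.cone n) := by
  refine ⟨ContinuousLinearMap.ext fun x => ?_, fun x hx => ?_⟩
  · rw [dualStar_apply, ofPairing_apply, ofPairing_apply, starMat_apply]
    refine (S.pairing_matStar f x).symm.trans ?_
    rw [show matStar (dualStar S.adj) f = f from hf.1]
  · rw [ofPairing_apply]
    have := pairing_nonneg_of_posSemidef (hf.2 n x hx) 1
    rwa [Matrix.conjTranspose_one, lr_one_one (x : Matrix (Fin n) (Fin n) X)] at this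

theorem mem_cone_iff_bidualEquiv_mem {n : ℕ} (z : S.dual.dual.Mat n) :
    z ∈ S.dual.dual.cone n ↔ S.bidualEquiv n z ∈
      dualCone (dualStar (S.starMat n)) (dualCone (S.starMat n) (S.cone n)) := by
  refine ⟨fun hz => ⟨?_, fun F hF => ?_⟩, fun hz => ?_⟩
  · rw [← bidualEquiv_starMat]
    exact congrArg _ hz.1
  · rw [bidualEquiv_apply]
    have := pairing_nonneg_of_posSemidef (hz.2 n _ (S.theta_mem_cone hF)) 1
    rwa [Matrix.conjTranspose_one, lr_one_one] at this
  · have hs : matStar (dualStar S.dual.adj) z = z := by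
      refine (S.bidualEquiv n).injective ?_
      refine (S.bidualEquiv_starMat z).trans hz.1
    refine ⟨hs, fun m f hf => S.dual.amp_posSemidef hs hf.1 fun b => ?_⟩
    have := hz.2 _ (S.ofPairing_mem_dualCone (S.dual.lr_mem_cone b hf))
    rwa [bidualEquiv_ofPairing] at this

end Order

/-! ### Canonical images and weak topologies -/

theorem bidualEquiv_kappa {n : ℕ} (x : S.Mat n) :
    S.bidualEquiv n (S.kappa x) = NormedSpace.inclusionInDoubleDual ℂ (S.Mat n) x := by
  refine ContinuousLinearMap.ext fun F => ?_
  rw [bidualEquiv_apply]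
  exact S.pairing_theta F x

theorem isHomeomorph_bidualEquiv (n : ℕ) :
    @IsHomeomorph (S.dual.dual.Mat n) (StrongDual ℂ (StrongDual ℂ (S.Mat n)))
      (S.dual.sigma n) (weakStar (StrongDual ℂ (S.Mat n))) (S.bidualEquiv n) := by
  let t₁ : TopologicalSpace (S.dual.dual.Mat n) := S.dual.sigma n
  let t₂ : TopologicalSpace (StrongDual ℂ (StrongDual ℂ (S.Mat n))) :=
    weakStar (StrongDual ℂ (S.Mat n))
  have hc₁ : ∀ f : Matrix (Fin n) (Fin n) (StrongDual ℂ X), @Continuous (S.dual.dual.Mat n) ℂ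
      t₁ _ fun z => pairing z f := fun f =>
    (continuous_apply f).comp (continuous_induced_dom (f := fun
      (z : S.dual.dual.Mat n) (g : Matrix (Fin n) (Fin n) (StrongDual ℂ X)) => pairing z g))
  have hc₂ : ∀ F : StrongDual ℂ (S.Mat n),
      @Continuous (StrongDual ℂ (StrongDual ℂ (S.Mat n))) ℂ t₂ _ fun G => G F := fun F =>
    (continuous_apply F).comp continuous_induced_dom
  have h₁ : @Continuous _ _ t₁ t₂ (S.bidualEquiv n) := by
    refine continuous_induced_rng.mpr (continuous_pi fun F => ?_)
    simpa only [Function.comp_def, bidualEquiv_apply] using hc₁ (S.theta F)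
  have h₂ : @Continuous _ _ t₂ t₁ (S.bidualEquiv n).symm := by
    refine continuous_induced_rng.mpr (continuous_pi fun f => ?_)
    convert hc₂ (S.ofPairing f) using 2 with G
    rw [Function.comp_apply, ← bidualEquiv_ofPairing, LinearIsometryEquiv.apply_symm_apply]
  exact (@isHomeomorph_iff_exists_inverse _ _ t₁ t₂ _).mpr
    ⟨h₁, (S.bidualEquiv n).symm, (S.bidualEquiv n).symm_apply_apply,
      (S.bidualEquiv n).apply_symm_apply, h₂⟩

end SMOS

end OpSpace

end

theorem mainTheorem10 {X : Type*} [NormedAddCommGroup X] [NormedSpace ℂ X]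
    (S : OpSpace.SMOS X) (n : ℕ) :
    ∃ Λ : S.dual.dual.Mat n ≃ₗᵢ[ℂ] StrongDual ℂ (StrongDual ℂ (S.Mat n)),
      (∀ (z : S.dual.dual.Mat n) (F : StrongDual ℂ (S.Mat n)),
        Λ z F = OpSpace.pairing z (S.theta F)) ∧
      (∀ z : S.dual.dual.Mat n,
        Λ (S.dual.dual.starMat n z) = OpSpace.dualStar (OpSpace.dualStar (S.starMat n)) (Λ z)) ∧
      (∀ z : S.dual.dual.Mat n, z ∈ S.dual.dual.cone n ↔
        Λ z ∈ OpSpace.dualCone (OpSpace.dualStar (S.starMat n))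
          (OpSpace.dualCone (S.starMat n) (S.cone n))) ∧
      (∀ x : S.Mat n, Λ (S.kappa x) = NormedSpace.inclusionInDoubleDual ℂ (S.Mat n) x) ∧
      Λ '' Set.range (S.kappa (n := n)) =
        Set.range (NormedSpace.inclusionInDoubleDual ℂ (S.Mat n)) ∧
      @IsHomeomorph (S.dual.dual.Mat n) (StrongDual ℂ (StrongDual ℂ (S.Mat n)))
        (S.dual.sigma n) (OpSpace.weakStar (StrongDual ℂ (S.Mat n))) Λ := by
  exact ⟨S.bidualEquiv n, S.bidualEquiv_apply, S.bidualEquiv_starMat,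
    S.mem_cone_iff_bidualEquiv_mem, S.bidualEquiv_kappa,
    by rw [← Set.range_comp]; exact congrArg Set.range (funext S.bidualEquiv_kappa),
    S.isHomeomorph_bidualEquiv n⟩
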